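/- **Setting.** For a differentiable $g:\mathbb R^d\times\mathbb R^d\to\mathbb R$ let $F_g(z)=(\nabla_x g(x,y),-\nabla_y g(x,y))$, $z=(x,y)\in\mathbb R^{2d}$. Call $g$ *$L$-smooth* if $\|F_g(z_1)-F_g(z_2)\|\le L\|z_1-z_2\|$, and *$\mu$-strongly-convex-strongly-concave* if $\langle F_g(z_1)-F_g(z_2),z_1-z_2\rangle\ge\mu\|z_1-z_2\|^2$, for all $z_1,z_2\in\mathbb R^{2d}$. Twice differentiable functions $f_1,\dots,f_M$ with average $f=\frac1M\sum_m f_m$ are *$\delta$-related* if at every $(x,y)$ and for every $m$ each of $\nabla^2_{xx}f_m-\nabla^2_{xx}f$, $\nabla^2_{xy}f_m-\nabla^2_{xy}f$, $\nabla^2_{yy}f_m-\nabla^2_{yy}f$ has operator norm at most $\delta$. A *gossip matrix* of a connected undirected graph $\mathcal G$ on $\{1,\dots,M\}$, $M\ge2$, is a symmetric $W\in\mathbb R^{M\times M}$ with $W\mathbf 1=\mathbf 1$, $w_{ii}>0$, $w_{ij}>0$ if $\{i,j\}$ is an edge, and $w_{ij}=0$ for all other $i\ne j$. Its *eigengap*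 is $1-\max\{\lambda_2(W),|\lambda_{\min}(W)|\}$, with eigenvalues $\lambda_1\ge\lambda_2\ge\dots\ge\lambda_M=\lambda_{\min}$. *Decentralized algorithms.* Every agent $m$ has memories $\mathcal M^x_m,\mathcal M^y_m\subseteq\mathbb R^d$, initially $\{0\}$. * *Local computation.* Between communication rounds each agent $m$ adds finitely many points, one pair after another, $x$ to $\mathcal M_m^x$ and $y$ to $\mathcal M_m^y$, where for some $\alpha,\beta,\theta,\varphi\ge0$ with $\alpha+\beta>0$, $\theta+\varphi>0$: the vector $\alpha x+\beta\nabla_xf_m(x,y)$ lies in the span of the vectors $u$, $(\nabla^2_{xx}f_m(x'',y'')+D)u$, $(\nabla^2_{xx}f_m(x'',y'')+D)^{-1}u$ with $u\in\{x',\nabla_xf_m(x',y')\}$ and $\nabla^2_{xy}f_m(x'',y'')v$ with $v\in\{y',\nabla_yf_m(x',y')\}$; and $\theta y-\varphi\nabla_yf_m(x,y)$ lies in the span of the vectors $v$, $(\nabla^2_{yy}f_m(x'',y'')+D)v$, $(\nabla^2_{yy}f_m(x'',y'')+D)^{-1}v$ and $\nabla^2_{xy}f_m(x'',y'')^{T}u$,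 with $u,v$ as before. Here $x',x''\in\mathcal M^x_m$, $y',y''\in\mathcal M_m^y$ and the diagonal matrices $D$ (with the inverses existing where used) are arbitrary. * *Communication round.* Simultaneously for all $m$, $\mathcal M^x_m$ is replaced by $\operatorname{span}\bigcup_{i:\,w_{mi}\ne0}\mathcal M_i^x$, and $\mathcal M^y_m$ by $\operatorname{span}\bigcup_{i:\,w_{mi}\ne0}\mathcal M_i^y$. * *Output* after $k$ rounds: any $x^k\in\operatorname{span}\bigcup_m\mathcal M^x_m$, $y^k\in\operatorname{span}\bigcup_m\mathcal M^y_m$. **Corollary.** There are absolute constants $c,c_0>0$ such that for all $\mu,\delta>0$, all $L>\max\{\mu,\delta\}$, all $\rho\in(0,1]$ and all $K\in\mathbb N$ there exist $d$, $M\ge 2$, a connected graph $\mathcal G$ on $\{1,\dots,M\}$ with a gossip matrix $W$ of eigengap $\rho$, and twice differentiable, $L$-smooth, $\mu$-strongly-convex-strongly-concave, $\delta$-related functions $f_1,\dots,f_M:\mathbb R^d\times\mathbb R^d\to\mathbb R$, with $\mu$-strongly-convex-strongly-concave average $f$, such that the problem $\min_x\max_yf(x,y)$ has a saddle point $z^*=(x^*,y^*)$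 with $x^*\ne0$, $y^*\ne0$, and the following holds for every $\varepsilon>0$ and every $k\le K$: if some decentralized algorithm as above has, after $k$ communication rounds, an output $z^k$ with $\|z^k-z^*\|^2\le\varepsilon$ (an $\varepsilon$-solution), then $$k\ \ge\ c\cdot\frac1{\sqrt\rho}\Big(1+\frac\delta\mu\Big)\log\frac{\|y^*\|^2}{\varepsilon}\qquad\text{whenever }\varepsilon\le c_0\|y^*\|^2 ,$$ and, in case $\delta\ge2\mu$, also $$k\ \ge\ c\cdot\frac1{\sqrt\rho}\Big(1+\frac\delta\mu\Big)\log\frac{\|z^*\|^2}{\varepsilon}\qquad\text{whenever }\varepsilon\le c_0\|z^*\|^2 .$$ -/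

import Mathlib

namespace DistSPP

/-- Euclidean space `ℝᵈ`. -/
abbrev Vec (d : ℕ) := EuclideanSpace ℝ (Fin d)

/-- The joint variable `z = (x, y) ∈ ℝ²ᵈ`, with the Euclidean norm and inner product. -/
abbrev ZVec (d : ℕ) := WithLp 2 (Vec d × Vec d)

/-- Functions `f(x, y)` on `ℝᵈ × ℝᵈ`. -/
abbrev SFun (d : ℕ) := Vec d → Vec d → ℝ

noncomputable section

variable {d M : ℕ}

/-! ### Gradients and Hessian blocks -/

/-- `∇ₓ f(x, y)`. -/
def gradX (f : SFun d) (x y : Vec d) : Vec d := gradient (fun u => f u y) x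

/-- `∇ᵧ f(x, y)`. -/
def gradY (f : SFun d) (x y : Vec d) : Vec d := gradient (fun v => f x v) y

/-- `∇²ₓₓ f(x, y)`, as an operator. -/
def hessXX (f : SFun d) (x y : Vec d) : Vec d →L[ℝ] Vec d :=
  fderiv ℝ (fun u => gradX f u y) x

/-- `∇²ₓᵧ f(x, y)`, the operator from `y`-directions to `x`-directions with matrix
`(∂²f / ∂xᵢ∂yⱼ)ᵢⱼ`; its transpose is the adjoint operator. -/
def hessXY (f : SFun d) (x y : Vec d) : Vec d →L[ℝ] Vec d :=
  fderiv ℝ (fun v => gradX f x v) y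

/-- `∇²ᵧᵧ f(x, y)`, as an operator. -/
def hessYY (f : SFun d) (x y : Vec d) : Vec d →L[ℝ] Vec d :=
  fderiv ℝ (fun v => gradY f x v) y

/-- The operator `F(z) = (∇ₓ f(x, y), -∇ᵧ f(x, y))`. -/
def saddleOp (f : SFun d) (z : ZVec d) : ZVec d :=
  WithLp.toLp 2 (gradX f z.fst z.snd, -gradY f z.fst z.snd)

/-! ### The class of problems -/

/-- `f` is twice differentiable as a function of `(x, y)`. -/
def TwiceDifferentiable (f : SFun d) : Prop :=
  Differentiable ℝ (Function.uncurry f) ∧ Differentiable ℝ (fderiv ℝ (Function.uncurry f))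

/-- `L`-smoothness: the operator `F` is `L`-Lipschitz on `ℝ²ᵈ`. -/
def Smooth (L : ℝ) (f : SFun d) : Prop :=
  ∀ z₁ z₂ : ZVec d, ‖saddleOp f z₁ - saddleOp f z₂‖ ≤ L * ‖z₁ - z₂‖

/-- `μ`-strong convexity-strong concavity on `ℝ²ᵈ`. -/
def StronglyConvexConcave (μ : ℝ) (f : SFun d) : Prop :=
  ∀ z₁ z₂ : ZVec d, μ * ‖z₁ - z₂‖ ^ 2 ≤ inner ℝ (saddleOp f z₁ - saddleOp f z₂) (z₁ - z₂)

/-- The global objective `f = (1/M) ∑ₘ fₘ`. -/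
def average (f : Fin M → SFun d) : SFun d :=
  fun x y => (1 / (M : ℝ)) * ∑ m, f m x y

/-- The local functions are `δ`-related. -/
def Related (δ : ℝ) (f : Fin M → SFun d) : Prop :=
  ∀ (m : Fin M) (x y : Vec d),
    ‖hessXX (f m) x y - hessXX (average f) x y‖ ≤ δ ∧
    ‖hessXY (f m) x y - hessXY (average f) x y‖ ≤ δ ∧
    ‖hessYY (f m) x y - hessYY (average f) x y‖ ≤ δ

/-- `(xs, ys)` solves `min_x max_y f(x, y)` over `ℝᵈ × ℝᵈ`: it is a saddle point of `f`. -/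
def IsSolution (f : SFun d) (xs ys : Vec d) : Prop :=
  IsSaddlePointOn Set.univ Set.univ f xs ys

/-! ### The network -/

/-- `W` is a gossip matrix of the graph `G`. -/
structure IsGossip (G : SimpleGraph (Fin M)) (W : Matrix (Fin M) (Fin M) ℝ) : Prop where
  diag_pos : ∀ i, 0 < W i i
  edge_pos : ∀ i j, G.Adj i j → 0 < W i j
  non_edge : ∀ i j, i ≠ j → ¬ G.Adj i j → W i j = 0
  symm : W.IsHermitian
  stochastic : ∀ i, ∑ j, W i j = 1

/-- The eigengap `1 - max {λ₂(W), |λ_min(W)|}`; `eigenvalues₀` lists the eigenvalues in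
nonincreasing order, with multiplicity. -/
def eigengap (hM : 2 ≤ M) {W : Matrix (Fin M) (Fin M) ℝ} (hW : W.IsHermitian) : ℝ :=
  1 - max (hW.eigenvalues₀ ⟨1, by rw [Fintype.card_fin]; omega⟩)
    |hW.eigenvalues₀ ⟨M - 1, by rw [Fintype.card_fin]; omega⟩|

/-! ### The optimization/communication oracle -/

/-- The operator of multiplication by the diagonal matrix with diagonal `D`. -/
def diagOp (D : Fin d → ℝ) : Vec d →L[ℝ] Vec d :=
  Matrix.toEuclideanCLM (𝕜 := ℝ) (Matrix.diagonal D)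

/-- The vectors whose span is available for an `x`-update of an agent that holds the function `f`
and the memories `Mx`, `My`. -/
inductive GenX (f : SFun d) (Mx My : Set (Vec d)) : Vec d → Prop
  | point (x' : Vec d) (hx' : x' ∈ Mx) : GenX f Mx My x'
  | grad (x' y' : Vec d) (hx' : x' ∈ Mx) (hy' : y' ∈ My) : GenX f Mx My (gradX f x' y')
  | hess_point (x' x'' y'' : Vec d) (D : Fin d → ℝ) (hx' : x' ∈ Mx) (hx'' : x'' ∈ Mx)
      (hy'' : y'' ∈ My) : GenX f Mx My ((hessXX f x'' y'' + diagOp D) x')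
  | hess_grad (x' y' x'' y'' : Vec d) (D : Fin d → ℝ) (hx' : x' ∈ Mx) (hy' : y' ∈ My)
      (hx'' : x'' ∈ Mx) (hy'' : y'' ∈ My) :
      GenX f Mx My ((hessXX f x'' y'' + diagOp D) (gradX f x' y'))
  | inv_point (x' x'' y'' : Vec d) (D : Fin d → ℝ) (T : Vec d ≃L[ℝ] Vec d) (hx' : x' ∈ Mx)
      (hx'' : x'' ∈ Mx) (hy'' : y'' ∈ My)
      (hT : (T : Vec d →L[ℝ] Vec d) = hessXX f x'' y'' + diagOp D) :
      GenX f Mx My (T.symm x')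
  | inv_grad (x' y' x'' y'' : Vec d) (D : Fin d → ℝ) (T : Vec d ≃L[ℝ] Vec d) (hx' : x' ∈ Mx)
      (hy' : y' ∈ My) (hx'' : x'' ∈ Mx) (hy'' : y'' ∈ My)
      (hT : (T : Vec d →L[ℝ] Vec d) = hessXX f x'' y'' + diagOp D) :
      GenX f Mx My (T.symm (gradX f x' y'))
  | cross_point (y' x'' y'' : Vec d) (hy' : y' ∈ My) (hx'' : x'' ∈ Mx) (hy'' : y'' ∈ My) :
      GenX f Mx My (hessXY f x'' y'' y')
  | cross_grad (x' y' x'' y'' : Vec d) (hx' : x' ∈ Mx) (hy' : y' ∈ My) (hx'' : x'' ∈ Mx)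
      (hy'' : y'' ∈ My) : GenX f Mx My (hessXY f x'' y'' (gradY f x' y'))

/-- The vectors whose span is available for a `y`-update of an agent that holds the function `f`
and the memories `Mx`, `My`. -/
inductive GenY (f : SFun d) (Mx My : Set (Vec d)) : Vec d → Prop
  | point (y' : Vec d) (hy' : y' ∈ My) : GenY f Mx My y'
  | grad (x' y' : Vec d) (hx' : x' ∈ Mx) (hy' : y' ∈ My) : GenY f Mx My (gradY f x' y')
  | hess_point (y' x'' y'' : Vec d) (D : Fin d → ℝ) (hy' : y' ∈ My) (hx'' : x'' ∈ Mx)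
      (hy'' : y'' ∈ My) : GenY f Mx My ((hessYY f x'' y'' + diagOp D) y')
  | hess_grad (x' y' x'' y'' : Vec d) (D : Fin d → ℝ) (hx' : x' ∈ Mx) (hy' : y' ∈ My)
      (hx'' : x'' ∈ Mx) (hy'' : y'' ∈ My) :
      GenY f Mx My ((hessYY f x'' y'' + diagOp D) (gradY f x' y'))
  | inv_point (y' x'' y'' : Vec d) (D : Fin d → ℝ) (T : Vec d ≃L[ℝ] Vec d) (hy' : y' ∈ My)
      (hx'' : x'' ∈ Mx) (hy'' : y'' ∈ My)
      (hT : (T : Vec d →L[ℝ] Vec d) = hessYY f x'' y'' + diagOp D) :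
      GenY f Mx My (T.symm y')
  | inv_grad (x' y' x'' y'' : Vec d) (D : Fin d → ℝ) (T : Vec d ≃L[ℝ] Vec d) (hx' : x' ∈ Mx)
      (hy' : y' ∈ My) (hx'' : x'' ∈ Mx) (hy'' : y'' ∈ My)
      (hT : (T : Vec d →L[ℝ] Vec d) = hessYY f x'' y'' + diagOp D) :
      GenY f Mx My (T.symm (gradY f x' y'))
  | cross_point (x' x'' y'' : Vec d) (hx' : x' ∈ Mx) (hx'' : x'' ∈ Mx) (hy'' : y'' ∈ My) :
      GenY f Mx My (ContinuousLinearMap.adjoint (hessXY f x'' y'') x')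
  | cross_grad (x' y' x'' y'' : Vec d) (hx' : x' ∈ Mx) (hy' : y' ∈ My) (hx'' : x'' ∈ Mx)
      (hy'' : y'' ∈ My) :
      GenY f Mx My (ContinuousLinearMap.adjoint (hessXY f x'' y'') (gradX f x' y'))

/-- The pair `(x, y)` may be computed locally by an agent that holds the function `f` and the
memories `Mx`, `My`. -/
def LocallyComputable (f : SFun d) (Mx My : Set (Vec d)) (x y : Vec d) : Prop :=
  ∃ α β θ φ : ℝ, 0 ≤ α ∧ 0 ≤ β ∧ 0 ≤ θ ∧ 0 ≤ φ ∧ 0 < α + β ∧ 0 < θ + φ ∧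
    α • x + β • gradX f x y ∈ Submodule.span ℝ {v | GenX f Mx My v} ∧
    θ • y - φ • gradY f x y ∈ Submodule.span ℝ {v | GenY f Mx My v}

/-- The memory of agent `m` after a communication round with the gossip matrix `W`: the span of the
memories of `m` and of its neighbours (the agents `i` with `W m i ≠ 0`). -/
def communicate (W : Matrix (Fin M) (Fin M) ℝ) (mem : Fin M → Set (Vec d)) :
    Fin M → Set (Vec d) :=
  fun m => (Submodule.span ℝ (⋃ i ∈ {i : Fin M | W m i ≠ 0}, mem i) : Set (Vec d))

/-- `Reachable f W k Mx My`: the agents' memories can be `Mx`, `My` at some moment of a run of an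
algorithm of the oracle class, after exactly `k` communication rounds. -/
inductive Reachable (f : Fin M → SFun d) (W : Matrix (Fin M) (Fin M) ℝ) :
    ℕ → (Fin M → Set (Vec d)) → (Fin M → Set (Vec d)) → Prop
  | init : Reachable f W 0 (fun _ => {0}) (fun _ => {0})
  | compute (k : ℕ) (Mx My : Fin M → Set (Vec d)) (m : Fin M) (x y : Vec d)
      (h : Reachable f W k Mx My) (hxy : LocallyComputable (f m) (Mx m) (My m) x y) :
      Reachable f W k (Function.update Mx m (insert x (Mx m)))
        (Function.update My m (insert y (My m)))
  | comm (k : ℕ) (Mx My : Fin M → Set (Vec d)) (h : Reachable f W k Mx My) :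
      Reachable f W (k + 1) (communicate W Mx) (communicate W My)

/-- `(x, y)` can be the global output of an algorithm of the oracle class after `k` communication
rounds. -/
def IsOutput (f : Fin M → SFun d) (W : Matrix (Fin M) (Fin M) ℝ) (k : ℕ) (x y : Vec d) : Prop :=
  ∃ Mx My : Fin M → Set (Vec d), Reachable f W k Mx My ∧
    x ∈ Submodule.span ℝ (⋃ m, Mx m) ∧ y ∈ Submodule.span ℝ (⋃ m, My m)

end

end DistSPP

/-!
The agents are arranged in layers `0, …, p` with `p` of order `1 / √ρ` such that only equal or
consecutive layers communicate, and at least a third of the agents sit at each of the two ends. An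
instance is a chain of coordinates whose links alternate between the agents of layer `0` and those
of layer `p`, while the functions of all other agents do not couple coordinates. To reveal the next
coordinate of the chain, information has to cross the network, so after `k` rounds only about
`k / p` coordinates are nonzero anywhere.

If `2 μ ≤ δ`, the chain alternates between the coordinates of `x` and `y`, coupled bilinearly. The
solution decays geometrically along it, with `log (1 / r)` of order `μ / δ` for the ratio `r`, which
gives the bound with the factor `1 + δ / μ`.

If `δ < 2 μ`, a chain of length more than `K` runs through the coordinates of `x`, and `y` interacts
with its last coordinate only. Then `y` remains zero during all of the `K` rounds, the error is at
least `‖y*‖²`, and no `ε`-solution with `ε < ‖y*‖²` is found.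
-/

namespace DistSPP

noncomputable section

variable {d M : ℕ}

/-! ### Quadratic saddle functions -/

/-- The quadratic saddle function
`(μ/2)‖x‖² + ½⟨x, P x⟩ + ⟨x, Q y⟩ - (μ/2)‖y‖² - ⟨b, x⟩`, the shape of all functions in both hard
instances. -/
def quad (μ : ℝ) (P Q : Vec d →L[ℝ] Vec d) (b : Vec d) : SFun d := fun x y =>
  μ / 2 * inner ℝ x x + 1 / 2 * inner ℝ x (P x) + inner ℝ x (Q y) - μ / 2 * inner ℝ y y
    - inner ℝ b x

section Quad

variable (μ : ℝ) {P : Vec d →L[ℝ] Vec d} (Q : Vec d →L[ℝ] Vec d) (b : Vec d)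

lemma twiceDifferentiable_quad (P : Vec d →L[ℝ] Vec d) : TwiceDifferentiable (quad μ P Q b) := by
  have hx : ContDiff ℝ 2 (fun z : Vec d × Vec d => z.1) := contDiff_fst
  have hy : ContDiff ℝ 2 (fun z : Vec d × Vec d => z.2) := contDiff_snd
  have h : ContDiff ℝ 2 (Function.uncurry (quad μ P Q b)) :=
    ((((contDiff_const.mul (hx.inner ℝ hx)).add
      (contDiff_const.mul (hx.inner ℝ (P.contDiff.comp hx)))).add
      (hx.inner ℝ (Q.contDiff.comp hy))).sub (contDiff_const.mul (hy.inner ℝ hy))).sub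
      (contDiff_const.inner ℝ hx)
  exact ⟨h.differentiable (by norm_num),
    (h.fderiv_right (m := 1) (by norm_num)).differentiable (by norm_num)⟩

lemma gradX_quad (hP : P.IsSymmetric) (x y : Vec d) :
    gradX (quad μ P Q b) x y = μ • x + P x + Q y - b := by
  have hid : HasFDerivAt (fun u : Vec d => u) (.id ℝ _) x := hasFDerivAt_id x
  have hquad := ((((hid.inner ℝ hid).const_mul (μ / 2)).add
    ((hid.inner ℝ P.hasFDerivAt).const_mul (1 / 2))).add
    (hid.inner ℝ (hasFDerivAt_const (Q y) x))).sub_const (μ / 2 * inner ℝ y y)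
  refine (hasGradientAt_iff_hasFDerivAt.2 ((hquad.sub
    ((hasFDerivAt_const b x).inner ℝ hid)).congr_fderiv ?_)).gradient
  ext v
  have hsymm : inner ℝ x (P v) = inner ℝ v (P x) := by
    rw [← real_inner_comm]; exact hP v x
  simp only [_root_.sub_apply, _root_.add_apply, _root_.smul_apply, _root_.zero_apply,
    ContinuousLinearMap.comp_apply, ContinuousLinearMap.prod_apply, ContinuousLinearMap.id_apply,
    fderivInnerCLM_apply, InnerProductSpace.toDual_apply_apply, map_sub, map_add, map_smul,
    smul_eq_mul, inner_zero_left, inner_zero_right, hsymm, real_inner_comm v]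
  ring

lemma gradY_quad (P : Vec d →L[ℝ] Vec d) (x y : Vec d) :
    gradY (quad μ P Q b) x y = ContinuousLinearMap.adjoint Q x - μ • y := by
  have hid : HasFDerivAt (fun u : Vec d => u) (.id ℝ _) y := hasFDerivAt_id y
  refine (hasGradientAt_iff_hasFDerivAt.2 ((((((hasFDerivAt_const x y).inner ℝ
    Q.hasFDerivAt).const_add (μ / 2 * inner ℝ x x + 1 / 2 * inner ℝ x (P x))).sub
    ((hid.inner ℝ hid).const_mul (μ / 2))).sub_const (inner ℝ b x)).congr_fderiv ?_)).gradient
  ext v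
  simp only [_root_.sub_apply, _root_.smul_apply, _root_.zero_apply,
    ContinuousLinearMap.comp_apply, ContinuousLinearMap.prod_apply, ContinuousLinearMap.id_apply,
    fderivInnerCLM_apply, InnerProductSpace.toDual_apply_apply, map_sub, map_smul, smul_eq_mul,
    inner_zero_left, real_inner_comm v, ContinuousLinearMap.adjoint_inner_right, real_inner_comm x]
  ring

lemma hessXX_quad (hP : P.IsSymmetric) (x y : Vec d) :
    hessXX (quad μ P Q b) x y = μ • .id ℝ _ + P := by
  simp_rw [hessXX, gradX_quad μ Q b hP]
  exact ((((hasFDerivAt_id x).const_smul μ).add P.hasFDerivAt).add_const _ |>.sub_const _).fderiv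

lemma hessXY_quad (hP : P.IsSymmetric) (x y : Vec d) : hessXY (quad μ P Q b) x y = Q := by
  simp_rw [hessXY, gradX_quad μ Q b hP]
  exact ((Q.hasFDerivAt.const_add _).sub_const _).fderiv

lemma hessYY_quad (P : Vec d →L[ℝ] Vec d) (x y : Vec d) :
    hessYY (quad μ P Q b) x y = -(μ • .id ℝ _) := by
  simp_rw [hessYY, gradY_quad]
  exact (((hasFDerivAt_id y).const_smul μ).const_sub _).fderiv

lemma saddleOp_quad_sub (hP : P.IsSymmetric) (z₁ z₂ : ZVec d) :
    saddleOp (quad μ P Q b) z₁ - saddleOp (quad μ P Q b) z₂ =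
      μ • (z₁ - z₂) + (WithLp.toLp 2 (P (z₁ - z₂).fst, 0) +
        WithLp.toLp 2 (Q (z₁ - z₂).snd, -ContinuousLinearMap.adjoint Q (z₁ - z₂).fst)) := by
  simp only [saddleOp, gradX_quad μ Q b hP, gradY_quad]
  rw [← WithLp.toLp_sub, ← WithLp.toLp_add]
  apply WithLp.ofLp_injective
  ext1 <;> simp [smul_sub] <;> module

lemma norm_toLp_skew_le (z : ZVec d) :
    ‖WithLp.toLp 2 (Q z.snd, -ContinuousLinearMap.adjoint Q z.fst)‖ ≤ ‖Q‖ * ‖z‖ := by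
  refine le_of_sq_le_sq ?_ (by positivity)
  have hsnd := pow_le_pow_left₀ (norm_nonneg _) (Q.le_opNorm z.snd) 2
  have hfst := pow_le_pow_left₀ (norm_nonneg _)
    ((ContinuousLinearMap.adjoint Q).le_opNorm z.fst) 2
  rw [LinearIsometryEquiv.norm_map] at hfst
  simp only [WithLp.prod_norm_sq_eq_of_L2, WithLp.toLp_fst, WithLp.toLp_snd, mul_pow,
    norm_neg] at *
  linarith

lemma smooth_quad (hP : P.IsSymmetric) {L : ℝ} (hμ : 0 ≤ μ) (hL : μ + ‖P‖ + ‖Q‖ ≤ L) :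
    Smooth L (quad μ P Q b) := by
  intro z₁ z₂
  rw [saddleOp_quad_sub μ Q b hP]
  set z := z₁ - z₂
  have hPz : ‖WithLp.toLp 2 (P z.fst, (0 : Vec d))‖ ≤ ‖P‖ * ‖z‖ := by
    rw [WithLp.norm_toLp_fst]
    exact (P.le_opNorm _).trans
      (mul_le_mul_of_nonneg_left (WithLp.norm_fst_le _ z) (norm_nonneg _))
  calc _ ≤ ‖μ • z‖ + (‖P‖ * ‖z‖ + ‖Q‖ * ‖z‖) :=
        norm_add_le_of_le le_rfl (norm_add_le_of_le hPz (norm_toLp_skew_le Q z))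
    _ = (μ + ‖P‖ + ‖Q‖) * ‖z‖ := by rw [norm_smul, Real.norm_of_nonneg hμ]; ring
    _ ≤ L * ‖z‖ := mul_le_mul_of_nonneg_right hL (norm_nonneg _)

lemma stronglyConvexConcave_quad (hP : P.IsPositive) :
    StronglyConvexConcave μ (quad μ P Q b) := by
  intro z₁ z₂
  rw [saddleOp_quad_sub μ Q b hP.isSymmetric]
  set z := z₁ - z₂
  have hPz : inner ℝ (WithLp.toLp 2 (P z.fst, (0 : Vec d))) z = inner ℝ (P z.fst) z.fst := by
    simp [WithLp.prod_inner_apply]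
  have hskew : inner ℝ (WithLp.toLp 2 (Q z.snd, -ContinuousLinearMap.adjoint Q z.fst)) z = 0 := by
    simp [WithLp.prod_inner_apply, ContinuousLinearMap.adjoint_inner_left,
      real_inner_comm z.fst]
  rw [inner_add_left, inner_add_left, hPz, hskew, real_inner_smul_left,
    real_inner_self_eq_norm_sq, add_zero]
  exact le_add_of_nonneg_right (hP.inner_nonneg_left _)

variable {μ Q b}

lemma quad_sub_quad_left (hP : P.IsSymmetric) (u x y : Vec d) :
    quad μ P Q b u y - quad μ P Q b x y = inner ℝ (μ • x + P x + Q y - b) (u - x) +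
      (μ / 2 * inner ℝ (u - x) (u - x) + 1 / 2 * inner ℝ (P (u - x)) (u - x)) := by
  have hsymm : inner ℝ (P u) x = inner ℝ (P x) u := by rw [← real_inner_comm]; exact (hP x u).symm
  simp only [quad, map_sub, inner_sub_left, inner_sub_right, inner_add_left,
    real_inner_smul_left, hsymm, real_inner_comm u x, real_inner_comm (P u) u,
    real_inner_comm (P x) x, real_inner_comm (Q y)]
  ring

lemma quad_sub_quad_right (x v y : Vec d) :
    quad μ P Q b x v - quad μ P Q b x y =
      inner ℝ (ContinuousLinearMap.adjoint Q x - μ • y) (v - y) -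
        μ / 2 * inner ℝ (v - y) (v - y) := by
  simp only [quad, inner_sub_left, inner_sub_right, real_inner_smul_left,
    ContinuousLinearMap.adjoint_inner_left, real_inner_comm v y]
  ring

lemma isSolution_quad (hP : P.IsPositive) (hμ : 0 ≤ μ) {x y : Vec d}
    (hx : μ • x + P x + Q y = b) (hy : ContinuousLinearMap.adjoint Q x = μ • y) :
    IsSolution (quad μ P Q b) x y := by
  intro u _ v _
  have hleft := quad_sub_quad_left (μ := μ) (Q := Q) (b := b) hP.isSymmetric u x y
  have hright := quad_sub_quad_right (μ := μ) (P := P) (Q := Q) (b := b) x v y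
  rw [hx, sub_self, inner_zero_left, zero_add] at hleft
  rw [hy, sub_self, inner_zero_left, zero_sub] at hright
  have hμx := mul_nonneg hμ (real_inner_self_nonneg (x := u - x))
  have hμy := mul_nonneg hμ (real_inner_self_nonneg (x := v - y))
  linarith [hP.inner_nonneg_left (u - x)]

lemma exists_stationary_point (hP : P.IsPositive) (hμ : 0 < μ) (Q : Vec d →L[ℝ] Vec d)
    (b : Vec d) :
    ∃ x y, μ • x + P x + Q y = b ∧ ContinuousLinearMap.adjoint Q x = μ • y := by
  set T : Vec d →L[ℝ] Vec d :=
    μ • .id ℝ _ + P + μ⁻¹ • (Q.comp (ContinuousLinearMap.adjoint Q)) with hT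
  have hinj : Function.Injective T := by
    refine (injective_iff_map_eq_zero T).2 fun x hx => ?_
    have hQ : inner ℝ (Q (ContinuousLinearMap.adjoint Q x)) x =
        ‖ContinuousLinearMap.adjoint Q x‖ ^ 2 := by
      rw [← ContinuousLinearMap.adjoint_inner_right, real_inner_self_eq_norm_sq]
    have hTx : μ * ‖x‖ ^ 2 + inner ℝ (P x) x + μ⁻¹ * ‖ContinuousLinearMap.adjoint Q x‖ ^ 2 = 0 := by
      have := congr(inner ℝ $hx x)
      simpa only [hT, _root_.add_apply, _root_.smul_apply, ContinuousLinearMap.id_apply,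
        ContinuousLinearMap.comp_apply, inner_add_left, real_inner_smul_left, inner_zero_left,
        hQ, real_inner_self_eq_norm_sq] using this
    have hQx : 0 ≤ μ⁻¹ * ‖ContinuousLinearMap.adjoint Q x‖ ^ 2 := by positivity
    have hx0 : μ * ‖x‖ ^ 2 ≤ 0 := by linarith [hP.inner_nonneg_left x]
    simpa using le_antisymm (nonpos_of_mul_nonpos_right hx0 hμ) (sq_nonneg _)
  obtain ⟨x, hx⟩ := (LinearMap.injective_iff_surjective (f := T.toLinearMap)).1 hinj b
  refine ⟨x, μ⁻¹ • ContinuousLinearMap.adjoint Q x, ?_, (smul_inv_smul₀ hμ.ne' _).symm⟩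
  rw [map_smul]
  exact hx

end Quad

/-- The average `(1/M) ∑ₘ Tₘ` of linear operators. -/
def opAverage (T : Fin M → Vec d →L[ℝ] Vec d) : Vec d →L[ℝ] Vec d := (1 / (M : ℝ)) • ∑ m, T m

lemma average_quad [NeZero M] (μ : ℝ) (P Q : Fin M → Vec d →L[ℝ] Vec d) (b : Vec d) :
    average (fun m => quad μ (P m) (Q m) b) = quad μ (opAverage P) (opAverage Q) b := by
  have hM : (M : ℝ) ≠ 0 := NeZero.ne _
  ext x y
  simp only [average, quad, opAverage, Finset.sum_add_distrib, Finset.sum_sub_distrib,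
    _root_.smul_apply, _root_.sum_apply, real_inner_smul_right, inner_sum,
    Finset.sum_const, Finset.card_univ, Fintype.card_fin, nsmul_eq_mul, ← Finset.mul_sum]
  field_simp

lemma isPositive_opAverage {P : Fin M → Vec d →L[ℝ] Vec d} (hP : ∀ m, (P m).IsPositive) :
    (opAverage P).IsPositive :=
  (ContinuousLinearMap.isPositive_sum _ fun m _ => hP m).smul_of_nonneg (by positivity)

lemma norm_opAverage_le {T : Fin M → Vec d →L[ℝ] Vec d} {C : ℝ} (hC : 0 ≤ C)
    (hT : ∀ m, ‖T m‖ ≤ C) : ‖opAverage T‖ ≤ C := by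
  have hsum : ‖∑ m, T m‖ ≤ M * C := by
    simpa using norm_sum_le_of_le Finset.univ fun m _ => hT m
  calc ‖opAverage T‖ ≤ 1 / M * (M * C) := by
        rw [opAverage, norm_smul, Real.norm_of_nonneg (by positivity)]
        gcongr
    _ = M / M * C := by ring
    _ ≤ C := mul_le_of_le_one_left hC (div_self_le_one _)

lemma related_quad [NeZero M] {μ δ : ℝ} {P Q : Fin M → Vec d →L[ℝ] Vec d} {b : Vec d}
    (hδ : 0 ≤ δ) (hP : ∀ m, (P m).IsPositive) (hPδ : ∀ m, ‖P m - opAverage P‖ ≤ δ)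
    (hQδ : ∀ m, ‖Q m - opAverage Q‖ ≤ δ) : Related δ (fun m => quad μ (P m) (Q m) b) := by
  intro m x y
  have hav := (isPositive_opAverage hP).isSymmetric
  rw [average_quad, hessXX_quad _ _ _ (hP m).isSymmetric, hessXX_quad _ _ _ hav,
    hessXY_quad _ _ _ (hP m).isSymmetric, hessXY_quad _ _ _ hav, hessYY_quad, hessYY_quad,
    add_sub_add_left_eq_sub, sub_self, norm_zero]
  exact ⟨hPδ m, hQδ m, hδ⟩

/-- The requirements on a problem instance: membership of `f` in the function class, and a saddle
point of the average with nonzero components. -/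
structure IsAdmissible (L μ δ : ℝ) (f : Fin M → SFun d) (xs ys : Vec d) : Prop where
  regular : ∀ m, TwiceDifferentiable (f m) ∧ Smooth L (f m) ∧ StronglyConvexConcave μ (f m)
  average_regular : StronglyConvexConcave μ (average f)
  related : Related δ f
  solution : IsSolution (average f) xs ys
  fst_ne_zero : xs ≠ 0
  snd_ne_zero : ys ≠ 0

lemma isAdmissible_quad [NeZero M] {L μ δ C D : ℝ} {P Q : Fin M → Vec d →L[ℝ] Vec d}
    {b xs ys : Vec d} (hμ : 0 ≤ μ) (hP : ∀ m, (P m).IsPositive) (hPC : ∀ m, ‖P m‖ ≤ C)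
    (hQD : ∀ m, ‖Q m‖ ≤ D) (hC : 2 * C ≤ δ) (hD : 2 * D ≤ δ) (hL : μ + C + D ≤ L)
    (hx : μ • xs + opAverage P xs + opAverage Q ys = b)
    (hy : ContinuousLinearMap.adjoint (opAverage Q) xs = μ • ys) (hxs : xs ≠ 0) (hys : ys ≠ 0) :
    IsAdmissible L μ δ (fun m => quad μ (P m) (Q m) b) xs ys := by
  have hC0 : 0 ≤ C := (norm_nonneg _).trans (hPC 0)
  have hD0 : 0 ≤ D := (norm_nonneg _).trans (hQD 0)
  have hPavg := isPositive_opAverage hP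
  have hPdiff : ∀ m, ‖P m - opAverage P‖ ≤ δ := fun m =>
    (norm_sub_le_of_le (hPC m) (norm_opAverage_le hC0 hPC)).trans (by linarith)
  have hQdiff : ∀ m, ‖Q m - opAverage Q‖ ≤ δ := fun m =>
    (norm_sub_le_of_le (hQD m) (norm_opAverage_le hD0 hQD)).trans (by linarith)
  refine ⟨fun m => ⟨twiceDifferentiable_quad _ _ _ _, ?_, stronglyConvexConcave_quad _ _ _ (hP m)⟩,
    ?_, related_quad (by linarith) hP hPdiff hQdiff, ?_, hxs, hys⟩
  · exact smooth_quad _ _ _ (hP m).isSymmetric hμ (by linarith [hPC m, hQD m])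
  · exact average_quad μ P Q b ▸ stronglyConvexConcave_quad _ _ _ hPavg
  · exact average_quad μ P Q b ▸ isSolution_quad hPavg hμ hx hy

/-! ### Subspaces stable under the oracle -/

/-- Local computation with `f` never leaves the subspaces `X`, `Y`. -/
def Confined (f : SFun d) (X Y : Submodule ℝ (Vec d)) : Prop :=
  ∀ ⦃Mx My : Set (Vec d)⦄, Mx ⊆ X → My ⊆ Y →
    ∀ ⦃x y : Vec d⦄, LocallyComputable f Mx My x y → x ∈ X ∧ y ∈ Y

/-- The oracle of `f`, queried at points of `X × Y`, maps the subspaces `X`, `Y` into themselves, as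
do all diagonal matrices. -/
structure OracleStable (f : SFun d) (X Y : Submodule ℝ (Vec d)) : Prop where
  diag_x : ∀ D, ∀ u ∈ X, diagOp D u ∈ X
  diag_y : ∀ D, ∀ v ∈ Y, diagOp D v ∈ Y
  grad_x : ∀ x ∈ X, ∀ y ∈ Y, gradX f x y ∈ X
  grad_y : ∀ x ∈ X, ∀ y ∈ Y, gradY f x y ∈ Y
  hess_xx : ∀ x ∈ X, ∀ y ∈ Y, ∀ u ∈ X, hessXX f x y u ∈ X
  hess_yy : ∀ x ∈ X, ∀ y ∈ Y, ∀ v ∈ Y, hessYY f x y v ∈ Y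
  hess_xy : ∀ x ∈ X, ∀ y ∈ Y, ∀ v ∈ Y, hessXY f x y v ∈ X
  hess_yx : ∀ x ∈ X, ∀ y ∈ Y, ∀ u ∈ X, ContinuousLinearMap.adjoint (hessXY f x y) u ∈ Y

lemma symm_mem_of_coe_eq_add {E : Type*} [NormedAddCommGroup E] [NormedSpace ℝ E]
    [FiniteDimensional ℝ E] {X : Submodule ℝ E} {T : E ≃L[ℝ] E} {A B : E →L[ℝ] E}
    (hT : (T : E →L[ℝ] E) = A + B) (hA : ∀ u ∈ X, A u ∈ X) (hB : ∀ u ∈ X, B u ∈ X)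
    {u : E} (hu : u ∈ X) : T.symm u ∈ X := by
  have hle : X.map (T.toLinearEquiv : E →ₗ[ℝ] E) ≤ X := by
    rintro _ ⟨v, hv, rfl⟩
    have hTv : T v = A v + B v := congr($hT v)
    exact hTv ▸ X.add_mem (hA v hv) (hB v hv)
  rw [← Submodule.eq_of_le_of_finrank_eq hle (T.toLinearEquiv.finrank_map_eq X)] at hu
  obtain ⟨v, hv, rfl⟩ := hu
  simpa using hv

namespace OracleStable

variable {f : SFun d} {X Y : Submodule ℝ (Vec d)} {Mx My : Set (Vec d)}

lemma span_genX_le (h : OracleStable f X Y) (hMx : Mx ⊆ X) (hMy : My ⊆ Y) :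
    Submodule.span ℝ {v | GenX f Mx My v} ≤ X := by
  refine Submodule.span_le.2 fun v hv => ?_
  cases hv with
  | point _ hx' => exact hMx hx'
  | grad _ _ hx' hy' => exact h.grad_x _ (hMx hx') _ (hMy hy')
  | hess_point _ _ _ D hx' hx'' hy'' =>
    exact X.add_mem (h.hess_xx _ (hMx hx'') _ (hMy hy'') _ (hMx hx')) (h.diag_x D _ (hMx hx'))
  | hess_grad _ _ _ _ D hx' hy' hx'' hy'' =>
    have hg := h.grad_x _ (hMx hx') _ (hMy hy')
    exact X.add_mem (h.hess_xx _ (hMx hx'') _ (hMy hy'') _ hg) (h.diag_x D _ hg)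
  | inv_point _ _ _ D T hx' hx'' hy'' hT =>
    exact symm_mem_of_coe_eq_add hT (h.hess_xx _ (hMx hx'') _ (hMy hy'')) (h.diag_x D) (hMx hx')
  | inv_grad _ _ _ _ D T hx' hy' hx'' hy'' hT =>
    exact symm_mem_of_coe_eq_add hT (h.hess_xx _ (hMx hx'') _ (hMy hy'')) (h.diag_x D)
      (h.grad_x _ (hMx hx') _ (hMy hy'))
  | cross_point _ _ _ hy' hx'' hy'' => exact h.hess_xy _ (hMx hx'') _ (hMy hy'') _ (hMy hy')
  | cross_grad _ _ _ _ hx' hy' hx'' hy'' =>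
    exact h.hess_xy _ (hMx hx'') _ (hMy hy'') _ (h.grad_y _ (hMx hx') _ (hMy hy'))

lemma span_genY_le (h : OracleStable f X Y) (hMx : Mx ⊆ X) (hMy : My ⊆ Y) :
    Submodule.span ℝ {v | GenY f Mx My v} ≤ Y := by
  refine Submodule.span_le.2 fun v hv => ?_
  cases hv with
  | point _ hy' => exact hMy hy'
  | grad _ _ hx' hy' => exact h.grad_y _ (hMx hx') _ (hMy hy')
  | hess_point _ _ _ D hy' hx'' hy'' =>
    exact Y.add_mem (h.hess_yy _ (hMx hx'') _ (hMy hy'') _ (hMy hy')) (h.diag_y D _ (hMy hy'))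
  | hess_grad _ _ _ _ D hx' hy' hx'' hy'' =>
    have hg := h.grad_y _ (hMx hx') _ (hMy hy')
    exact Y.add_mem (h.hess_yy _ (hMx hx'') _ (hMy hy'') _ hg) (h.diag_y D _ hg)
  | inv_point _ _ _ D T hy' hx'' hy'' hT =>
    exact symm_mem_of_coe_eq_add hT (h.hess_yy _ (hMx hx'') _ (hMy hy'')) (h.diag_y D) (hMy hy')
  | inv_grad _ _ _ _ D T hx' hy' hx'' hy'' hT =>
    exact symm_mem_of_coe_eq_add hT (h.hess_yy _ (hMx hx'') _ (hMy hy'')) (h.diag_y D)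
      (h.grad_y _ (hMx hx') _ (hMy hy'))
  | cross_point _ _ _ hx' hx'' hy'' => exact h.hess_yx _ (hMx hx'') _ (hMy hy'') _ (hMx hx')
  | cross_grad _ _ _ _ hx' hy' hx'' hy'' =>
    exact h.hess_yx _ (hMx hx'') _ (hMy hy'') _ (h.grad_x _ (hMx hx') _ (hMy hy'))

end OracleStable

/-- The subspaces `X`, `Y` are stable under diagonal matrices and under the constant Hessian blocks
`P`, `Q`, `Qᵀ` of a quadratic saddle function. -/
structure BlockStable (P Q : Vec d →L[ℝ] Vec d) (X Y : Submodule ℝ (Vec d)) : Prop where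
  diag_x : ∀ D, ∀ x ∈ X, diagOp D x ∈ X
  diag_y : ∀ D, ∀ y ∈ Y, diagOp D y ∈ Y
  xx : ∀ x ∈ X, P x ∈ X
  xy : ∀ y ∈ Y, Q y ∈ X
  yx : ∀ x ∈ X, ContinuousLinearMap.adjoint Q x ∈ Y

lemma eq_zero_of_skew_coupled {α β θ φ μ A B r s : ℝ} (hμ : 0 < μ) (hα : 0 ≤ α) (hβ : 0 ≤ β)
    (hθ : 0 ≤ θ) (hφ : 0 ≤ φ) (hαβ : 0 < α + β) (hθφ : 0 < θ + φ) (hA : 0 ≤ A) (hB : 0 ≤ B)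
    (hr : 0 ≤ r) (hAs : A = 0 → s = 0) (hBs : B = 0 → s = 0)
    (hx : α * A + β * (μ * A + r + s) = 0) (hy : θ * B + φ * (μ * B - s) = 0) :
    A = 0 ∧ B = 0 := by
  have pos_add_mul : ∀ {a b : ℝ}, 0 ≤ a → 0 ≤ b → 0 < a + b → 0 < a + b * μ := by
    intro a b ha hb hab
    rcases hb.eq_or_lt with rfl | hb
    · simpa using hab
    · positivity
  have hs : s ≤ 0 := by
    by_contra! hs
    have hβ0 : β = 0 := by
      have hβs : β * s = 0 := by
        linarith [mul_nonneg hβ hs.le, mul_nonneg hα hA, mul_nonneg hβ (mul_nonneg hμ.le hA),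
          mul_nonneg hβ hr]
      exact (mul_eq_zero.1 hβs).resolve_right hs.ne'
    subst hβ0
    exact hs.ne' (hAs ((mul_eq_zero.1 (by simpa using hx)).resolve_left (by linarith)))
  have hB0 : B = 0 := by
    have hpos := pos_add_mul hθ hφ hθφ
    have : (θ + φ * μ) * B = 0 := by
      linarith [mul_nonneg hpos.le hB, mul_nonneg hφ (neg_nonneg.2 hs)]
    exact (mul_eq_zero.1 this).resolve_left hpos.ne'
  have hpos := pos_add_mul hα hβ hαβ
  have : (α + β * μ) * A = 0 := by
    rw [hBs hB0] at hx
    linarith [mul_nonneg hpos.le hA, mul_nonneg hβ hr]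
  exact ⟨(mul_eq_zero.1 this).resolve_left hpos.ne', hB0⟩

namespace BlockStable

variable {μ : ℝ} {P Q : Vec d →L[ℝ] Vec d} {b : Vec d} {X Y : Submodule ℝ (Vec d)}

lemma oracleStable_quad (h : BlockStable P Q X Y) (hP : P.IsSymmetric) (hb : b ∈ X) :
    OracleStable (quad μ P Q b) X Y where
  diag_x := h.diag_x
  diag_y := h.diag_y
  grad_x x hx y hy := by
    rw [gradX_quad _ _ _ hP]
    exact X.sub_mem (X.add_mem (X.add_mem (X.smul_mem _ hx) (h.xx x hx)) (h.xy y hy)) hb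
  grad_y x hx y hy := by
    rw [gradY_quad]
    exact Y.sub_mem (h.yx x hx) (Y.smul_mem _ hy)
  hess_xx _ _ _ _ u hu := by
    rw [hessXX_quad _ _ _ hP]
    exact X.add_mem (X.smul_mem _ hu) (h.xx u hu)
  hess_yy _ _ _ _ v hv := by
    rw [hessYY_quad]
    exact Y.neg_mem (Y.smul_mem _ hv)
  hess_xy _ _ _ _ := by
    rw [hessXY_quad _ _ _ hP]
    exact h.xy
  hess_yx _ _ _ _ := by
    rw [hessXY_quad _ _ _ hP]
    exact h.yx

/-- The components `x₂ ∈ Xᗮ`, `y₂ ∈ Yᗮ` of the computed point satisfy the same implicit equations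
with right-hand side zero; tested with `x₂` and `y₂`, these share the term `⟨Q y₂, x₂⟩` up to sign,
which monotonicity forces to vanish. -/
lemma mem_of_implicit_step (h : BlockStable P Q X Y) (hμ : 0 < μ) (hP : P.IsPositive) (hb : b ∈ X)
    {α β θ φ : ℝ} (hα : 0 ≤ α) (hβ : 0 ≤ β) (hθ : 0 ≤ θ) (hφ : 0 ≤ φ) (hαβ : 0 < α + β)
    (hθφ : 0 < θ + φ) {x y : Vec d} (hx : α • x + β • gradX (quad μ P Q b) x y ∈ X)
    (hy : θ • y - φ • gradY (quad μ P Q b) x y ∈ Y) : x ∈ X ∧ y ∈ Y := by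
  rw [gradX_quad _ _ _ hP.isSymmetric] at hx
  rw [gradY_quad] at hy
  obtain ⟨x₁, hx₁, x₂, hx₂, rfl⟩ := X.exists_add_mem_mem_orthogonal x
  obtain ⟨y₁, hy₁, y₂, hy₂, rfl⟩ := Y.exists_add_mem_mem_orthogonal y
  set s := inner ℝ (Q y₂) x₂ with hs
  set r := inner ℝ (P x₂) x₂
  have hr : 0 ≤ r := hP.inner_nonneg_left x₂
  have ex : α * ‖x₂‖ ^ 2 + β * (μ * ‖x₂‖ ^ 2 + r + s) = 0 := by
    have := X.inner_right_of_mem_orthogonal hx hx₂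
    simpa only [map_add, smul_add, smul_sub, inner_add_left, inner_sub_left, real_inner_smul_left,
      X.inner_right_of_mem_orthogonal hx₁ hx₂, X.inner_right_of_mem_orthogonal (h.xx _ hx₁) hx₂,
      X.inner_right_of_mem_orthogonal (h.xy _ hy₁) hx₂, X.inner_right_of_mem_orthogonal hb hx₂,
      real_inner_self_eq_norm_sq, mul_zero, zero_add, sub_zero, ← mul_add] using this
  have ey : θ * ‖y₂‖ ^ 2 + φ * (μ * ‖y₂‖ ^ 2 - s) = 0 := by
    have := Y.inner_right_of_mem_orthogonal hy hy₂
    simp only [map_add, smul_add, smul_sub, inner_add_left, inner_sub_left, real_inner_smul_left,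
      Y.inner_right_of_mem_orthogonal hy₁ hy₂, Y.inner_right_of_mem_orthogonal (h.yx _ hx₁) hy₂,
      ContinuousLinearMap.adjoint_inner_left, real_inner_comm (Q y₂), real_inner_self_eq_norm_sq,
      mul_zero, zero_add] at this
    linarith
  obtain ⟨hx₂0, hy₂0⟩ : ‖x₂‖ ^ 2 = 0 ∧ ‖y₂‖ ^ 2 = 0 :=
    eq_zero_of_skew_coupled hμ hα hβ hθ hφ hαβ hθφ (sq_nonneg _) (sq_nonneg _) hr
      (fun hx0 => by simp [hs, (by simpa using hx0 : x₂ = 0)])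
      (fun hy0 => by simp [hs, (by simpa using hy0 : y₂ = 0)]) ex ey
  obtain rfl : x₂ = 0 := by simpa using hx₂0
  obtain rfl : y₂ = 0 := by simpa using hy₂0
  simpa using ⟨hx₁, hy₁⟩

lemma confined_quad (h : BlockStable P Q X Y) (hμ : 0 < μ) (hP : P.IsPositive) (hb : b ∈ X) :
    Confined (quad μ P Q b) X Y := by
  rintro Mx My hMx hMy x y ⟨α, β, θ, φ, hα, hβ, hθ, hφ, hαβ, hθφ, hx, hy⟩
  have hstable := h.oracleStable_quad (μ := μ) hP.isSymmetric hb
  exact h.mem_of_implicit_step hμ hP hb hα hβ hθ hφ hαβ hθφ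
    (hstable.span_genX_le hMx hMy hx) (hstable.span_genY_le hMx hMy hy)

end BlockStable

/-! ### Propagation of information through the network -/

/-- `h` arranges the agents in layers `0, …, p` such that `W` only connects agents of equal or
consecutive layers. The layers `0` and `p` play the two ends of the network. -/
structure IsHeight (W : Matrix (Fin M) (Fin M) ℝ) (h : Fin M → ℕ) (p : ℕ) : Prop where
  pos : 0 < p
  le : ∀ m, h m ≤ p
  step : ∀ i j, W i j ≠ 0 → h i ≤ h j + 1 ∧ h j ≤ h i + 1

/-- The increasing subspaces `X j`, `Y j` can be left by local computation only at layer `0` for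
even `j`, and only at layer `p` for odd `j`. -/
structure SplitFiltration (f : Fin M → SFun d) (h : Fin M → ℕ) (p : ℕ)
    (X Y : ℕ → Submodule ℝ (Vec d)) : Prop where
  mono_x : Monotone X
  mono_y : Monotone Y
  of_even : ∀ m j, Even j → h m ≠ 0 → Confined (f m) (X j) (Y j)
  of_odd : ∀ m j, Odd j → h m ≠ p → Confined (f m) (X j) (Y j)

/-- The number of communication rounds before agent `m` can leave the level `j` of a split
filtration: `j` crossings of the network, and the way from the end at which level `j` is left. -/
def exitTime (h : Fin M → ℕ) (p j : ℕ) (m : Fin M) : ℕ :=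
  j * p + if Even j then h m else p - h m

section Propagation

variable {W : Matrix (Fin M) (Fin M) ℝ} {h : Fin M → ℕ} {p : ℕ} {f : Fin M → SFun d}
  {X Y : ℕ → Submodule ℝ (Vec d)}

lemma exitTime_le_succ (hh : IsHeight W h p) {m i : Fin M} (hmi : W m i ≠ 0) (j : ℕ) :
    exitTime h p j m ≤ exitTime h p j i + 1 := by
  have := hh.step m i hmi
  unfold exitTime
  split_ifs <;> omega

/-- An agent at the end where level `j` is left reaches it only after leaving level `j - 1` at the
opposite end of the network, hence is still confined to level `j - 1`. -/
lemma SplitFiltration.exists_confined (hf : SplitFiltration f h p X Y) (hp : 0 < p) {k j : ℕ}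
    {m : Fin M} (hk : k < exitTime h p j m) :
    ∃ i ≤ j, k < exitTime h p i m ∧ Confined (f m) (X i) (Y i) := by
  rcases Nat.even_or_odd j with hj | hj
  · by_cases hm : h m = 0
    · obtain ⟨i, rfl⟩ : ∃ i, j = i + 1 :=
        Nat.exists_eq_succ_of_ne_zero (by rintro rfl; simp [exitTime, hm] at hk)
      have hi : ¬Even i := Nat.even_add_one.1 hj
      refine ⟨i, i.le_succ, ?_, hf.of_odd m i (Nat.not_even_iff_odd.1 hi) (by omega)⟩
      simpa [exitTime, hj, hi, hm, add_mul] using hk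
    · exact ⟨j, le_rfl, hk, hf.of_even m j hj hm⟩
  · by_cases hm : h m = p
    · obtain ⟨i, rfl⟩ : ∃ i, j = i + 1 := Nat.exists_eq_succ_of_ne_zero hj.pos.ne'
      have hi : Even i := by simpa [Nat.even_add_one] using Nat.not_even_iff_odd.2 hj
      refine ⟨i, i.le_succ, ?_, hf.of_even m i hi (by omega)⟩
      simpa [exitTime, hi, Nat.even_add_one, hm, add_mul] using hk
    · exact ⟨j, le_rfl, hk, hf.of_odd m j hj hm⟩

lemma communicate_subset {mem : Fin M → Set (Vec d)} {m : Fin M} {X : Submodule ℝ (Vec d)}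
    (hmem : ∀ i, W m i ≠ 0 → mem i ⊆ X) : communicate W mem m ⊆ X :=
  Submodule.span_le.2 (Set.iUnion₂_subset hmem)

lemma SplitFiltration.memory_subset (hf : SplitFiltration f h p X Y) (hh : IsHeight W h p)
    {k : ℕ} {Mx My : Fin M → Set (Vec d)} (hr : Reachable f W k Mx My) (m : Fin M) (j : ℕ)
    (hk : k < exitTime h p j m) : Mx m ⊆ X j ∧ My m ⊆ Y j := by
  induction hr generalizing m j with
  | init => simp
  | compute k Mx My a x y _ hxy ih =>
    rcases eq_or_ne m a with rfl | hm
    · obtain ⟨i, hij, hki, hclosed⟩ := hf.exists_confined hh.pos hk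
      obtain ⟨hx, hy⟩ := hclosed (ih m i hki).1 (ih m i hki).2 hxy
      simp only [Function.update_self]
      exact ⟨Set.insert_subset (hf.mono_x hij hx) (ih m j hk).1,
        Set.insert_subset (hf.mono_y hij hy) (ih m j hk).2⟩
    · simpa only [Function.update_of_ne hm] using ih m j hk
  | comm k Mx My _ ih =>
    have hnbr : ∀ i, W m i ≠ 0 → Mx i ⊆ X j ∧ My i ⊆ Y j := fun i hi =>
      ih i j (by have := exitTime_le_succ hh hi j; omega)
    exact ⟨communicate_subset fun i hi => (hnbr i hi).1,
      communicate_subset fun i hi => (hnbr i hi).2⟩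

lemma SplitFiltration.mem_of_isOutput (hf : SplitFiltration f h p X Y) (hh : IsHeight W h p)
    {k j : ℕ} (hk : k < j * p) {x y : Vec d} (ho : IsOutput f W k x y) : x ∈ X j ∧ y ∈ Y j := by
  obtain ⟨Mx, My, hr, hx, hy⟩ := ho
  have hmem := fun m => hf.memory_subset hh hr m j (hk.trans_le (Nat.le_add_right _ _))
  exact ⟨Submodule.span_le.2 (Set.iUnion_subset fun m => (hmem m).1) hx,
    Submodule.span_le.2 (Set.iUnion_subset fun m => (hmem m).2) hy⟩

end Propagation

/-- The vectors supported on the coordinates of position at most `j`. -/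
def coordSubspace (pos : Fin d → ℕ) (j : ℕ) : Submodule ℝ (Vec d) where
  carrier := {x | ∀ i, j < pos i → x i = 0}
  add_mem' hx hy i hi := by simp [hx i hi, hy i hi]
  zero_mem' _ _ := rfl
  smul_mem' c x hx i hi := by simp [hx i hi]

lemma coordSubspace_mono (pos : Fin d → ℕ) : Monotone (coordSubspace pos) :=
  fun _ _ hij _ hx i hi => hx i (hij.trans_lt hi)

lemma diagOp_mem_coordSubspace {pos : Fin d → ℕ} {j : ℕ} (D : Fin d → ℝ) (x : Vec d)
    (hx : x ∈ coordSubspace pos j) : diagOp D x ∈ coordSubspace pos j := fun i hi => by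
  simp [diagOp, Matrix.ofLp_toEuclideanCLM, Matrix.mulVec_diagonal, hx i hi]

/-! ### Operators split between the two ends of the network -/

/-- The operator `T₀` for the agents at layer `0`, `T₁` for those at layer `p`, zero otherwise. -/
def splitOp (h : Fin M → ℕ) (p : ℕ) (T₀ T₁ : Vec d →L[ℝ] Vec d) (m : Fin M) :
    Vec d →L[ℝ] Vec d :=
  if h m = 0 then T₀ else if h m = p then T₁ else 0

section SplitOp

variable {h : Fin M → ℕ} {p : ℕ} {T₀ T₁ : Vec d →L[ℝ] Vec d}

lemma splitOp_induction {motive : (Vec d →L[ℝ] Vec d) → Prop} (bottom : motive T₀)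
    (top : motive T₁) (middle : motive 0) (m : Fin M) : motive (splitOp h p T₀ T₁ m) := by
  unfold splitOp
  split_ifs <;> assumption

lemma opAverage_splitOp {n : ℕ} (hp : 0 < p)
    (hbot : (Finset.univ.filter fun m => h m = 0).card = n)
    (htop : (Finset.univ.filter fun m => h m = p).card = n) :
    opAverage (splitOp h p T₀ T₁) = ((n : ℝ) / M) • (T₀ + T₁) := by
  have hsplit : ∀ m, splitOp h p T₀ T₁ m =
      (if h m = 0 then T₀ else 0) + (if h m = p then T₁ else 0) := by
    intro m
    unfold splitOp
    split_ifs <;> first | omega | simp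
  simp only [opAverage, hsplit, Finset.sum_add_distrib, ← Finset.sum_filter, Finset.sum_const,
    hbot, htop]
  module

lemma splitFiltration_quad {μ : ℝ} {P₀ P₁ Q₀ Q₁ : Vec d →L[ℝ] Vec d} {b : Vec d}
    {posX posY : Fin d → ℕ} (hμ : 0 < μ) (hP₀ : P₀.IsPositive) (hP₁ : P₁.IsPositive)
    (hb : b ∈ coordSubspace posX 0)
    (hbot : ∀ j, Odd j → BlockStable P₀ Q₀ (coordSubspace posX j) (coordSubspace posY j))
    (htop : ∀ j, Even j → BlockStable P₁ Q₁ (coordSubspace posX j) (coordSubspace posY j)) :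
    SplitFiltration (fun m => quad μ (splitOp h p P₀ P₁ m) (splitOp h p Q₀ Q₁ m) b) h p
      (coordSubspace posX) (coordSubspace posY) := by
  have hb' : ∀ j, b ∈ coordSubspace posX j := fun j => coordSubspace_mono posX j.zero_le hb
  have hzero : ∀ j, BlockStable 0 0 (coordSubspace posX j) (coordSubspace posY j) := fun j =>
    { diag_x := diagOp_mem_coordSubspace
      diag_y := diagOp_mem_coordSubspace
      xx := fun _ _ => Submodule.zero_mem _
      xy := fun _ _ => Submodule.zero_mem _
      yx := fun _ _ => by simp }
  have hconf : ∀ j, Confined (quad μ 0 0 b) (coordSubspace posX j) (coordSubspace posY j) :=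
    fun j => (hzero j).confined_quad hμ ContinuousLinearMap.isPositive_zero (hb' j)
  refine ⟨coordSubspace_mono _, coordSubspace_mono _, fun m j hj hm => ?_, fun m j hj hm => ?_⟩
  · simp only [splitOp, if_neg hm]
    split_ifs
    exacts [(htop j hj).confined_quad hμ hP₁ (hb' j), hconf j]
  · simp only [splitOp, if_neg hm]
    split_ifs
    exacts [(hbot j hj).confined_quad hμ hP₀ (hb' j), hconf j]

end SplitOp

/-! ### Spectra of symmetric matrices -/

section Spectrum

open Matrix Module

lemma exists_minimal_eigenvector {E : Type*} [NormedAddCommGroup E] [InnerProductSpace ℝ E]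
    [FiniteDimensional ℝ E] [Nontrivial E] {T : E →ₗ[ℝ] E} (hT : T.IsSymmetric) :
    ∃ (c : ℝ) (u : E), u ≠ 0 ∧ T u = c • u ∧ ∀ v, c * inner ℝ v v ≤ inner ℝ v (T v) := by
  set b := hT.eigenvectorBasis rfl
  have hb : ∀ i, T (b i) = hT.eigenvalues rfl i • b i := hT.apply_eigenvectorBasis rfl
  have : Nonempty (Fin (finrank ℝ E)) := Fin.pos_iff_nonempty.1 finrank_pos
  obtain ⟨i, hi⟩ := Finite.exists_min (hT.eigenvalues rfl)
  refine ⟨_, b i, b.orthonormal.ne_zero i, hb i, fun v => ?_⟩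
  rw [← b.sum_inner_mul_inner v v, ← b.sum_inner_mul_inner v (T v), Finset.mul_sum]
  refine Finset.sum_le_sum fun j _ => ?_
  have hterm : inner ℝ v (b j) * inner ℝ (b j) (T v) =
      hT.eigenvalues rfl j * (inner ℝ v (b j) * inner ℝ (b j) v) := by
    rw [← hT (b j) v, hb, real_inner_smul_left, mul_left_comm]
  rw [hterm, real_inner_comm v]
  exact mul_le_mul_of_nonneg_right (hi j) (mul_self_nonneg _)

lemma inner_eq_dotProduct {ι : Type*} [Fintype ι] (u v : EuclideanSpace ℝ ι) :
    inner ℝ u v = u.ofLp ⬝ᵥ v.ofLp := by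
  rw [EuclideanSpace.inner_eq_star_dotProduct, star_trivial, dotProduct_comm]

variable {ι : Type*} [Fintype ι] {W : Matrix ι ι ℝ}

lemma exists_minimal_eigenvector_orthogonal [Nontrivial ι] (hW : W.IsHermitian) {w : ι → ℝ}
    (hw : W *ᵥ w = 0) :
    ∃ (c : ℝ) (u : ι → ℝ), u ≠ 0 ∧ w ⬝ᵥ u = 0 ∧ W *ᵥ u = c • u ∧
      ∀ v, w ⬝ᵥ v = 0 → c * (v ⬝ᵥ v) ≤ v ⬝ᵥ W *ᵥ v := by
  classical
  set T := toEuclideanLin W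
  have hT : T.IsSymmetric := isSymmetric_toEuclideanLin_iff.mpr hW
  set w' : EuclideanSpace ℝ ι := WithLp.toLp 2 w
  have hmem : ∀ v : EuclideanSpace ℝ ι, v ∈ (ℝ ∙ w')ᗮ ↔ w ⬝ᵥ v.ofLp = 0 := fun v => by
    rw [Submodule.mem_orthogonal_singleton_iff_inner_right, inner_eq_dotProduct]
  have hinv : ∀ v ∈ (ℝ ∙ w')ᗮ, T v ∈ (ℝ ∙ w')ᗮ := fun v _ => by
    have hw' : T w' = 0 := congrArg (WithLp.toLp 2) hw
    rw [Submodule.mem_orthogonal_singleton_iff_inner_right, ← hT w' v, hw', inner_zero_left]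
  have : Nontrivial (ℝ ∙ w')ᗮ := by
    have hline : finrank ℝ (ℝ ∙ w') ≤ 1 := (finrank_span_le_card {w'}).trans_eq (by simp)
    have hsum := (ℝ ∙ w').finrank_add_finrank_orthogonal
    have hcard := Fintype.one_lt_card (α := ι)
    rw [finrank_euclideanSpace] at hsum
    exact Module.nontrivial_of_finrank_pos (R := ℝ) (by omega)
  obtain ⟨c, u, hu, hTu, hmin⟩ := exists_minimal_eigenvector (hT.restrict_invariant hinv)
  refine ⟨c, (u : EuclideanSpace ℝ ι).ofLp, fun h => hu (Subtype.ext (WithLp.ofLp_injective 2 h)),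
    (hmem u).1 u.2, congrArg WithLp.ofLp (congrArg Subtype.val hTu), fun v hv => ?_⟩
  simpa only [Submodule.coe_inner, inner_eq_dotProduct] using! hmin ⟨WithLp.toLp 2 v, (hmem _).2 hv⟩

variable [DecidableEq ι]

lemma exists_sorted_eigenbasis (hW : W.IsHermitian) :
    ∃ v : OrthonormalBasis (Fin (Fintype.card ι)) ℝ (EuclideanSpace ℝ ι),
      ∀ i, W *ᵥ (v i).ofLp = hW.eigenvalues₀ i • (v i).ofLp :=
  have hT := isSymmetric_toEuclideanLin_iff.mpr hW
  ⟨hT.eigenvectorBasis finrank_euclideanSpace,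
    fun i => congrArg WithLp.ofLp (hT.apply_eigenvectorBasis finrank_euclideanSpace i)⟩

lemma exists_eigenvalues₀_eq (hW : W.IsHermitian) {u : ι → ℝ} (hu : u ≠ 0) {c : ℝ}
    (hc : W *ᵥ u = c • u) : ∃ i, hW.eigenvalues₀ i = c := by
  have hmem : c ∈ spectrum ℝ W := by
    rw [← spectrum_toLin']
    exact (End.hasEigenvalue_of_hasEigenvector (x := u)
      ⟨End.mem_eigenspace_iff.2 (by simpa using hc), hu⟩).mem_spectrum
  rw [hW.spectrum_real_eq_range_eigenvalues] at hmem
  obtain ⟨i, hi⟩ := hmem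
  exact ⟨_, hi⟩

lemma eigenvalues₀_nonneg (hW : W.PosSemidef) (i : Fin (Fintype.card ι)) :
    0 ≤ hW.isHermitian.eigenvalues₀ i := by
  have := hW.eigenvalues_nonneg (Fintype.equivOfCardEq (Fintype.card_fin _) i)
  rwa [IsHermitian.eigenvalues, Equiv.symm_apply_apply] at this

/-- Courant–Fischer for the second eigenvalue: the plane spanned by the eigenvectors `i` and `j`
contains a vector orthogonal to `w`. -/
lemma eigenvalues₀_le_of_forall_orthogonal (hW : W.IsHermitian) (w : ι → ℝ) {C : ℝ}
    (hC : ∀ u, w ⬝ᵥ u = 0 → u ⬝ᵥ W *ᵥ u ≤ C * (u ⬝ᵥ u)) {i j : Fin (Fintype.card ι)}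
    (hij : i < j) : hW.eigenvalues₀ j ≤ C := by
  obtain ⟨v, hv⟩ := exists_sorted_eigenbasis hW
  have hle := hW.eigenvalues₀_antitone hij.le
  have horth : ∀ a b, (v a).ofLp ⬝ᵥ (v b).ofLp = if a = b then 1 else 0 := fun a b => by
    rw [← inner_eq_dotProduct, orthonormal_iff_ite.1 v.orthonormal]
  have hplane : ∀ α β : ℝ, α * (w ⬝ᵥ (v i).ofLp) + β * (w ⬝ᵥ (v j).ofLp) = 0 →
      hW.eigenvalues₀ i * α ^ 2 + hW.eigenvalues₀ j * β ^ 2 ≤ C * (α ^ 2 + β ^ 2) := by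
    intro α β h
    have := hC (α • (v i).ofLp + β • (v j).ofLp) (by
      simpa only [dotProduct_add, dotProduct_smul, smul_eq_mul] using h)
    simp only [mulVec_add, mulVec_smul, hv, dotProduct_add, add_dotProduct, smul_dotProduct,
      dotProduct_smul, horth, smul_eq_mul, if_true, hij.ne, hij.ne', if_false] at this
    linarith
  by_cases h0 : w ⬝ᵥ (v j).ofLp = 0
  · simpa using hplane 0 1 (by simp [h0])
  · have hcomb := hplane (w ⬝ᵥ (v j).ofLp) (-(w ⬝ᵥ (v i).ofLp)) (by ring)
    have hpos : 0 < (w ⬝ᵥ (v j).ofLp) ^ 2 := by positivity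
    nlinarith [sq_nonneg (w ⬝ᵥ (v i).ofLp)]

lemma eigengap_eq (hM : 2 ≤ M) {W : Matrix (Fin M) (Fin M) ℝ} (hW : W.PosSemidef) {ρ : ℝ}
    (hρ : 0 < ρ) (hone : W *ᵥ 1 = 1)
    (hle : ∀ u : Fin M → ℝ, 1 ⬝ᵥ u = 0 → u ⬝ᵥ W *ᵥ u ≤ (1 - ρ) * (u ⬝ᵥ u))
    {u : Fin M → ℝ} (hu : u ≠ 0) (hWu : W *ᵥ u = (1 - ρ) • u) :
    eigengap hM hW.isHermitian = ρ := by
  have hcard : Fintype.card (Fin M) = M := Fintype.card_fin M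
  set ev := hW.isHermitian.eigenvalues₀
  have hanti : Antitone ev := hW.isHermitian.eigenvalues₀_antitone
  set i₁ : Fin (Fintype.card (Fin M)) := ⟨1, by omega⟩ with hi₁
  set iL : Fin (Fintype.card (Fin M)) := ⟨M - 1, by omega⟩ with hiL
  have hupper : ev i₁ ≤ 1 - ρ := eigenvalues₀_le_of_forall_orthogonal hW.isHermitian 1 hle
    (i := ⟨0, by omega⟩) (Fin.lt_def.2 one_pos)
  have hlower : 1 - ρ ≤ ev i₁ := by
    have : Nonempty (Fin M) := ⟨⟨0, by omega⟩⟩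
    obtain ⟨a, ha⟩ := exists_eigenvalues₀_eq hW.isHermitian one_ne_zero (c := 1)
      (by simpa using hone)
    obtain ⟨c, hc⟩ := exists_eigenvalues₀_eq hW.isHermitian hu hWu
    have hac : ¬c ≤ a := fun h => by have := hanti h; linarith
    have h1c : i₁ ≤ c := by rw [Fin.le_def] at hac ⊢; simp only [hi₁]; omega
    exact hc ▸ hanti h1c
  have hlast : |ev iL| ≤ ev i₁ := by
    rw [abs_of_nonneg (eigenvalues₀_nonneg hW iL)]
    exact hanti (by rw [Fin.le_def]; simp only [hi₁, hiL]; omega)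
  rw [eigengap, max_eq_left hlast, le_antisymm hupper hlower, sub_sub_cancel]

end Spectrum

/-! ### Gossip matrices with a prescribed eigengap -/

section Gossip

open Matrix

/-- The gossip matrix `I - s·Lap` of the graph `G`. -/
def lapGossip (G : SimpleGraph (Fin M)) [DecidableRel G.Adj] (s : ℝ) : Matrix (Fin M) (Fin M) ℝ :=
  1 - s • G.lapMatrix ℝ

section LapGossip

variable (G : SimpleGraph (Fin M)) [DecidableRel G.Adj]

lemma dotProduct_lapMatrix (u : Fin M → ℝ) :
    u ⬝ᵥ G.lapMatrix ℝ *ᵥ u = (∑ i, ∑ j, if G.Adj i j then (u i - u j) ^ 2 else 0) / 2 := by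
  rw [← Matrix.toLinearMap₂'_apply', SimpleGraph.lapMatrix_toLinearMap₂']

lemma dotProduct_lapMatrix_le {Δ : ℝ} (hΔ : ∀ i, (G.degree i : ℝ) ≤ Δ) (u : Fin M → ℝ) :
    u ⬝ᵥ G.lapMatrix ℝ *ᵥ u ≤ 2 * Δ * (u ⬝ᵥ u) := by
  have hcount : ∑ i, ∑ j, (if G.Adj i j then u i ^ 2 else 0) ≤ Δ * (u ⬝ᵥ u) := by
    rw [dotProduct, Finset.mul_sum]
    refine Finset.sum_le_sum fun i _ => ?_
    rw [← Finset.sum_filter, Finset.sum_const, ← G.neighborFinset_eq_filter,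
      G.card_neighborFinset_eq_degree, nsmul_eq_mul, sq]
    exact mul_le_mul_of_nonneg_right (hΔ i) (mul_self_nonneg _)
  have hswap : ∑ i, ∑ j, (if G.Adj i j then u j ^ 2 else 0) =
      ∑ i, ∑ j, (if G.Adj i j then u i ^ 2 else 0) := by
    rw [Finset.sum_comm]
    simp only [G.adj_comm]
  have hterm : ∑ i, ∑ j, (if G.Adj i j then (u i - u j) ^ 2 else 0) ≤
      2 * ∑ i, ∑ j, (if G.Adj i j then u i ^ 2 else 0) +
        2 * ∑ i, ∑ j, (if G.Adj i j then u j ^ 2 else 0) := by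
    simp only [Finset.mul_sum, ← Finset.sum_add_distrib]
    refine Finset.sum_le_sum fun i _ => Finset.sum_le_sum fun j _ => ?_
    split_ifs
    · linarith [sq_nonneg (u i + u j)]
    · simp
  rw [dotProduct_lapMatrix]
  linarith

lemma lapGossip_mulVec (s : ℝ) (u : Fin M → ℝ) :
    lapGossip G s *ᵥ u = u - s • (G.lapMatrix ℝ *ᵥ u) := by
  rw [lapGossip, sub_mulVec, one_mulVec, smul_mulVec]

lemma lapGossip_mulVec_one (s : ℝ) : lapGossip G s *ᵥ 1 = 1 := by
  rw [lapGossip_mulVec, show (1 : Fin M → ℝ) = fun _ => 1 from rfl,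
    G.lapMatrix_mulVec_const_eq_zero, smul_zero, sub_zero]

lemma dotProduct_lapGossip (s : ℝ) (u : Fin M → ℝ) :
    u ⬝ᵥ lapGossip G s *ᵥ u = u ⬝ᵥ u - s * (u ⬝ᵥ G.lapMatrix ℝ *ᵥ u) := by
  rw [lapGossip_mulVec, dotProduct_sub, dotProduct_smul, smul_eq_mul]

lemma lapGossip_apply_of_ne (s : ℝ) {i j : Fin M} (hij : i ≠ j) :
    lapGossip G s i j = if G.Adj i j then s else 0 := by
  simp [lapGossip, SimpleGraph.lapMatrix, SimpleGraph.degMatrix, hij, SimpleGraph.adjMatrix_apply]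

lemma lapGossip_apply_self (s : ℝ) (i : Fin M) : lapGossip G s i i = 1 - s * G.degree i := by
  simp [lapGossip, SimpleGraph.lapMatrix, SimpleGraph.degMatrix]

lemma isHermitian_lapGossip (s : ℝ) : (lapGossip G s).IsHermitian :=
  isHermitian_one.sub ((G.isHermitian_lapMatrix (R := ℝ)).smul (IsSelfAdjoint.all s))

variable {G} {s : ℝ}

lemma isGossip_lapGossip (hs : 0 < s) (hdeg : ∀ i, s * G.degree i < 1) :
    IsGossip G (lapGossip G s) where
  diag_pos i := by rw [lapGossip_apply_self]; exact sub_pos.2 (hdeg i)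
  edge_pos i j h := by rw [lapGossip_apply_of_ne G s h.ne, if_pos h]; exact hs
  non_edge i j hij h := by rw [lapGossip_apply_of_ne G s hij, if_neg h]
  symm := isHermitian_lapGossip G s
  stochastic i := by simpa [mulVec, dotProduct] using congrFun (lapGossip_mulVec_one G s) i

lemma posSemidef_lapGossip {Δ : ℝ} (hs : 0 ≤ s) (hΔ : ∀ i, (G.degree i : ℝ) ≤ Δ)
    (hsΔ : s * (2 * Δ) ≤ 1) : (lapGossip G s).PosSemidef := by
  refine .of_dotProduct_mulVec_nonneg (isHermitian_lapGossip G s) fun u => ?_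
  have hu : 0 ≤ u ⬝ᵥ u := dotProduct_self_star_nonneg u
  rw [star_trivial, dotProduct_lapGossip]
  nlinarith [mul_le_mul_of_nonneg_left (dotProduct_lapMatrix_le G hΔ u) hs]

variable (G) in
lemma exists_isGossip_eigengap_eq (hM : 2 ≤ M) {Δ κ ρ : ℝ} (hΔ : ∀ i, (G.degree i : ℝ) ≤ Δ)
    (hκ : ∀ u, 1 ⬝ᵥ u = 0 → κ * (u ⬝ᵥ u) ≤ u ⬝ᵥ G.lapMatrix ℝ *ᵥ u) (hκ0 : 0 < κ)
    (hρ : 0 < ρ) (hρκ : 2 * Δ * ρ ≤ κ) :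
    ∃ (W : Matrix (Fin M) (Fin M) ℝ) (hW : IsGossip G W), eigengap hM hW.symm = ρ := by
  have : Nontrivial (Fin M) := Fin.nontrivial_iff_two_le.2 hM
  have hLone : G.lapMatrix ℝ *ᵥ (1 : Fin M → ℝ) = 0 := G.lapMatrix_mulVec_const_eq_zero
  obtain ⟨c, u, hu, hu1, hLu, hmin⟩ :=
    exists_minimal_eigenvector_orthogonal (G.isHermitian_lapMatrix (R := ℝ)) hLone
  have hκc : κ ≤ c := by
    have hκu := hκ u hu1
    rw [hLu, dotProduct_smul, smul_eq_mul] at hκu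
    exact le_of_mul_le_mul_right hκu (dotProduct_self_star_pos_iff.2 hu)
  have hc : 0 < c := hκ0.trans_le hκc
  set s := ρ / c
  have hs : 0 < s := by positivity
  have hsc : s * c = ρ := div_mul_cancel₀ _ hc.ne'
  have hsΔ : s * (2 * Δ) ≤ 1 := by
    rw [div_mul_eq_mul_div, div_le_one hc]
    linarith
  refine ⟨lapGossip G s, isGossip_lapGossip hs fun i => ?_, ?_⟩
  · linarith [mul_le_mul_of_nonneg_left (hΔ i) hs.le]
  · refine eigengap_eq hM (posSemidef_lapGossip hs.le hΔ hsΔ) hρ (lapGossip_mulVec_one G s)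
      (fun v hv => ?_) hu ?_
    · rw [dotProduct_lapGossip, ← hsc]
      linarith [mul_le_mul_of_nonneg_left (hmin v hv) hs.le]
    · rw [lapGossip_mulVec, hLu, smul_smul, hsc, sub_smul, one_smul]

end LapGossip

section PathGraph

open SimpleGraph

variable {N : ℕ} [DecidableRel (pathGraph (N + 1)).Adj]

lemma dotProduct_lapMatrix_pathGraph (u : Fin (N + 1) → ℝ) :
    u ⬝ᵥ (pathGraph (N + 1)).lapMatrix ℝ *ᵥ u = ∑ e : Fin N, (u e.castSucc - u e.succ) ^ 2 := by
  have hsplit : ∀ i j : Fin (N + 1), (if (pathGraph (N + 1)).Adj i j then (u i - u j) ^ 2 else 0) =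
      (if i.val + 1 = j.val then (u i - u j) ^ 2 else 0) +
        (if j.val + 1 = i.val then (u j - u i) ^ 2 else 0) := by
    intro i j
    simp only [pathGraph_adj]
    split_ifs <;> first | omega | ring
  have hforward : ∑ i : Fin (N + 1), ∑ j : Fin (N + 1),
      (if i.val + 1 = j.val then (u i - u j) ^ 2 else 0) =
        ∑ e : Fin N, (u e.castSucc - u e.succ) ^ 2 := by
    have hlast : ∀ j : Fin (N + 1), ¬N + 1 = j.val := fun j => j.2.ne'
    have hsucc : ∀ (e : Fin N) (j : Fin (N + 1)), e.val + 1 = j.val ↔ j = e.succ := fun e j => by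
      rw [Fin.ext_iff, Fin.val_succ, eq_comm]
    simp only [Fin.sum_univ_castSucc (n := N) (fun _ => ∑ _ : Fin (N + 1), _), Fin.val_castSucc,
      Fin.val_last, hlast, hsucc, if_false, Finset.sum_const_zero, add_zero, Finset.sum_ite_eq',
      Finset.mem_univ, if_true]
  have hbackward := Finset.sum_comm (s := Finset.univ) (t := Finset.univ)
    (f := fun i j : Fin (N + 1) => if j.val + 1 = i.val then (u j - u i) ^ 2 else 0)
  rw [dotProduct_lapMatrix]
  simp only [hsplit, Finset.sum_add_distrib]
  rw [hbackward, hforward, add_self_div_two]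

lemma sq_sub_le_dotProduct_lapMatrix_pathGraph (u : Fin (N + 1) → ℝ) (i j : Fin (N + 1)) :
    (u i - u j) ^ 2 ≤ N * (u ⬝ᵥ (pathGraph (N + 1)).lapMatrix ℝ *ᵥ u) := by
  wlog hij : i ≤ j generalizing i j
  · rw [sub_sq_comm]
    exact this j i (not_le.1 hij).le
  set U : ℕ → ℝ := fun k => u (Fin.ofNat (N + 1) k)
  have henergy : u ⬝ᵥ (pathGraph (N + 1)).lapMatrix ℝ *ᵥ u =
      ∑ k ∈ Finset.range N, (U (k + 1) - U k) ^ 2 := by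
    rw [dotProduct_lapMatrix_pathGraph, Finset.sum_range]
    refine Finset.sum_congr rfl fun e _ => ?_
    rw [sub_sq_comm, ← Fin.ofNat_val_eq_self e.succ, ← Fin.ofNat_val_eq_self e.castSucc]
    rfl
  have htelescope : u j - u i = ∑ k ∈ Finset.Ico i.val j.val, (U (k + 1) - U k) := by
    rw [Finset.sum_Ico_sub U hij]
    simp only [U, Fin.ofNat_val_eq_self]
  have hsub : Finset.Ico i.val j.val ⊆ Finset.range N := fun k hk =>
    Finset.mem_range.2 ((Finset.mem_Ico.1 hk).2.trans_le (Fin.le_last j))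
  have hcard : ((Finset.Ico i.val j.val).card : ℝ) ≤ N := by
    exact_mod_cast (Finset.card_le_card hsub).trans_eq (Finset.card_range N)
  rw [sub_sq_comm, htelescope, henergy]
  refine sq_sum_le_card_mul_sum_sq.trans ?_
  gcongr

lemma poincare_pathGraph (u : Fin (N + 1) → ℝ) (hu : 1 ⬝ᵥ u = 0) :
    2 * (u ⬝ᵥ u) ≤ (N : ℝ) ^ 2 * (u ⬝ᵥ (pathGraph (N + 1)).lapMatrix ℝ *ᵥ u) := by
  set E := u ⬝ᵥ (pathGraph (N + 1)).lapMatrix ℝ *ᵥ u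
  have hsum : ∑ i, u i = 0 := by simpa [dotProduct] using hu
  have hvariance : ∑ i, ∑ j, (u i - u j) ^ 2 = (N + 1) * (2 * (u ⬝ᵥ u)) := by
    have hsq : ∀ i j, (u i - u j) ^ 2 = u i * u i - 2 * u i * u j + u j * u j := fun i j => by ring
    simp only [hsq, Finset.sum_add_distrib, Finset.sum_sub_distrib, ← Finset.mul_sum, hsum,
      mul_zero, Finset.sum_const_zero, Finset.sum_const, Finset.card_univ, Fintype.card_fin,
      nsmul_eq_mul, dotProduct]
    simp only [mul_left_comm (u _), ← Finset.mul_sum]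
    push_cast
    ring
  have hrow : ∀ i, ∑ j, (u i - u j) ^ 2 ≤ N ^ 2 * E := fun i => by
    rw [← Finset.add_sum_erase _ _ (Finset.mem_univ i), sub_self, zero_pow two_ne_zero, zero_add]
    calc _ ≤ ∑ _ ∈ Finset.univ.erase i, N * E :=
          Finset.sum_le_sum fun j _ => sq_sub_le_dotProduct_lapMatrix_pathGraph u i j
      _ = N ^ 2 * E := by simp [Finset.card_erase_of_mem]; ring
  have htotal : ∑ i, ∑ j, (u i - u j) ^ 2 ≤ (N + 1) * (N ^ 2 * E) :=
    (Finset.sum_le_sum fun i _ => hrow i).trans_eq (by simp)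
  exact le_of_mul_le_mul_left (hvariance ▸ htotal) (by positivity)

lemma degree_pathGraph_le_two (i : Fin (N + 1)) : (pathGraph (N + 1)).degree i ≤ 2 := by
  rw [← card_neighborFinset_eq_degree, ← Finset.card_map Fin.valEmbedding]
  refine (Finset.card_le_card (t := {i.val - 1, i.val + 1}) fun j hj => ?_).trans
    Finset.card_le_two
  obtain ⟨j, hij, rfl⟩ := Finset.mem_map.1 hj
  rw [mem_neighborFinset, pathGraph_adj] at hij
  simp only [Fin.valEmbedding_apply, Finset.mem_insert, Finset.mem_singleton]
  omega

lemma exists_isGossip_pathGraph (hN : 0 < N) {Δ ρ : ℝ}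
    (hΔ : ∀ i, ((pathGraph (N + 1)).degree i : ℝ) ≤ Δ) (hρ : 0 < ρ) (hρN : Δ * N ^ 2 * ρ ≤ 1) :
    ∃ (W : Matrix (Fin (N + 1)) (Fin (N + 1)) ℝ) (hW : IsGossip (pathGraph (N + 1)) W),
      eigengap (Nat.succ_le_succ hN) hW.symm = ρ := by
  refine exists_isGossip_eigengap_eq (pathGraph (N + 1)) _ (κ := 2 / N ^ 2) hΔ
    (fun u hu => ?_) (by positivity) hρ ?_
  · rw [div_mul_eq_mul_div, div_le_iff₀' (by positivity)]
    exact poincare_pathGraph u hu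
  · rw [le_div_iff₀ (by positivity)]
    linarith

end PathGraph

/-- The height function of the path with layers `0` and `p` of `n` vertices each, and single
vertices in the layers between. -/
def pathHeight (n p : ℕ) (i : Fin M) : ℕ := min (i + 1 - n) p

lemma isHeight_pathHeight {W : Matrix (Fin M) (Fin M) ℝ}
    (hW : IsGossip (SimpleGraph.pathGraph M) W) (n : ℕ) {p : ℕ} (hp : 0 < p) :
    IsHeight W (pathHeight n p) p where
  pos := hp
  le _ := min_le_right _ _
  step i j hij := by
    have hadj : i = j ∨ (SimpleGraph.pathGraph M).Adj i j := by
      by_contra! h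
      exact hij (hW.non_edge i j h.1 h.2)
    rw [SimpleGraph.pathGraph_adj, Fin.ext_iff] at hadj
    unfold pathHeight
    omega

lemma card_pathHeight_eq_zero {n p : ℕ} (hp : 0 < p) (hn : n ≤ M) :
    (Finset.univ.filter fun i : Fin M => pathHeight n p i = 0).card = n := by
  have hiff : ∀ i : Fin M, pathHeight n p i = 0 ↔ i.val < n := fun i => by
    unfold pathHeight; omega
  simp only [hiff, Fin.card_filter_val_lt, min_eq_right hn]

lemma card_pathHeight_eq_top {n p : ℕ} (hp : 0 < p) (hM : M + 1 = 2 * n + p) :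
    (Finset.univ.filter fun i : Fin M => pathHeight n p i = p).card = n := by
  have hiff : ∀ i : Fin M, pathHeight n p i = p ↔ ¬i.val < n + p - 1 := fun i => by
    unfold pathHeight; omega
  have hcompl := Finset.card_filter_add_card_filter_not (s := Finset.univ)
    fun i : Fin M => i.val < n + p - 1
  rw [Fin.card_filter_val_lt, Finset.card_univ, Fintype.card_fin] at hcompl
  simp only [hiff]
  omega

lemma exists_path_parameters {ρ : ℝ} (hρ : 0 < ρ) :
    ∃ N n p : ℕ, 0 < n ∧ 0 < p ∧ N + 2 = 2 * n + p ∧ p ≤ n + 1 ∧ 1 / (6 * √ρ) ≤ p ∧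
      (N = 1 ∨ 2 * (N : ℝ) ^ 2 * ρ ≤ 1) := by
  have hsqrt : 0 < √ρ := Real.sqrt_pos.2 hρ
  rcases lt_or_ge 1 (6 * √ρ) with hlarge | hsmall
  · refine ⟨1, 1, 1, one_pos, one_pos, rfl, by norm_num, ?_, .inl rfl⟩
    rw [div_le_iff₀ (by positivity), Nat.cast_one, one_mul]
    exact hlarge.le
  · set n := ⌊1 / (6 * √ρ)⌋₊
    have hn : 0 < n := Nat.floor_pos.2 ((one_le_div (by positivity)).2 hsmall)
    have hle : (n : ℝ) * (6 * √ρ) ≤ 1 := by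
      rw [← le_div_iff₀ (by positivity)]
      exact Nat.floor_le (by positivity)
    refine ⟨3 * n - 1, n, n + 1, hn, n.succ_pos, by omega, le_rfl, ?_, .inr ?_⟩
    · exact_mod_cast (Nat.lt_floor_add_one _).le
    · have hN : ((3 * n - 1 : ℕ) : ℝ) ≤ 3 * n := by exact_mod_cast Nat.sub_le _ _
      calc 2 * ((3 * n - 1 : ℕ) : ℝ) ^ 2 * ρ ≤ 2 * (3 * n : ℝ) ^ 2 * √ρ ^ 2 := by
            rw [Real.sq_sqrt hρ.le]
            gcongr
        _ = (n * (6 * √ρ)) ^ 2 / 2 := by ring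
        _ ≤ 1 := by nlinarith [show 0 ≤ n * (6 * √ρ) by positivity]

lemma exists_network {ρ : ℝ} (hρ : 0 < ρ) (hρ1 : ρ ≤ 1) :
    ∃ (M : ℕ) (hM : 2 ≤ M) (G : SimpleGraph (Fin M)) (W : Matrix (Fin M) (Fin M) ℝ)
      (hW : IsGossip G W) (h : Fin M → ℕ) (p n : ℕ), G.Connected ∧ eigengap hM hW.symm = ρ ∧
      IsHeight W h p ∧ 1 / (6 * √ρ) ≤ p ∧ M ≤ 3 * n ∧
      (Finset.univ.filter fun m => h m = 0).card = n ∧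
      (Finset.univ.filter fun m => h m = p).card = n := by
  classical
  obtain ⟨N, n, p, hn, hp, hN, hpn, hsep, hsize⟩ := exists_path_parameters hρ
  obtain ⟨W, hW, hgap⟩ : ∃ (W : Matrix (Fin (N + 1)) (Fin (N + 1)) ℝ)
      (hW : IsGossip (SimpleGraph.pathGraph (N + 1)) W),
        eigengap (show 2 ≤ N + 1 by omega) hW.symm = ρ := by
    rcases hsize with rfl | hsize
    · refine exists_isGossip_pathGraph one_pos (Δ := 1) (fun i => ?_) hρ (by simpa using hρ1)
      exact_mod_cast Nat.lt_succ_iff.1 ((SimpleGraph.pathGraph (1 + 1)).degree_lt_card_verts i)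
    · exact exists_isGossip_pathGraph (by omega)
        (fun i => by exact_mod_cast degree_pathGraph_le_two i) hρ hsize
  exact ⟨N + 1, by omega, _, W, hW, pathHeight n p, p, n, SimpleGraph.pathGraph_connected N, hgap,
    isHeight_pathHeight hW n hp, hsep, by omega, card_pathHeight_eq_zero hp (by omega),
    card_pathHeight_eq_top hp (by omega)⟩

end Gossip

/-! ### Weighted permutation operators -/

/-- The weighted permutation matrix `x ↦ (cᵢ x_{σ i})ᵢ`. -/
def permOp (c : Fin d → ℝ) (σ : Equiv.Perm (Fin d)) : Vec d →L[ℝ] Vec d :=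
  LinearMap.toContinuousLinearMap
    { toFun := fun x => WithLp.toLp 2 fun i => c i * x (σ i)
      map_add' := fun x y => by ext i; simp [mul_add]
      map_smul' := fun a x => by ext i; simp [mul_left_comm] }

@[simp]
lemma permOp_apply (c : Fin d → ℝ) (σ : Equiv.Perm (Fin d)) (x : Vec d) (i : Fin d) :
    permOp c σ x i = c i * x (σ i) := rfl

lemma norm_permOp_le {c : Fin d → ℝ} {C : ℝ} (hC : 0 ≤ C) (hc : ∀ i, |c i| ≤ C)
    (σ : Equiv.Perm (Fin d)) : ‖permOp c σ‖ ≤ C := by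
  refine ContinuousLinearMap.opNorm_le_bound _ hC fun x => le_of_sq_le_sq ?_ (by positivity)
  rw [mul_pow, EuclideanSpace.real_norm_sq_eq, EuclideanSpace.real_norm_sq_eq,
    ← Equiv.sum_comp σ (fun i => x i ^ 2), Finset.mul_sum]
  gcongr with i
  rw [permOp_apply, mul_pow]
  exact mul_le_mul_of_nonneg_right (sq_le_sq.2 ((hc i).trans (le_abs_self C))) (sq_nonneg _)

lemma adjoint_permOp (c : Fin d → ℝ) (σ : Equiv.Perm (Fin d)) :
    ContinuousLinearMap.adjoint (permOp c σ) = permOp (c ∘ σ.symm) σ.symm := by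
  refine ((ContinuousLinearMap.eq_adjoint_iff _ _).2 fun x y => ?_).symm
  simp only [PiLp.inner_apply, permOp_apply]
  rw [← Equiv.sum_comp σ]
  refine Finset.sum_congr rfl fun i _ => ?_
  simp [mul_left_comm, mul_assoc]

lemma permOp_mem_coordSubspace {c : Fin d → ℝ} {σ : Equiv.Perm (Fin d)} {pos pos' : Fin d → ℕ}
    {j : ℕ} (h : ∀ i, j < pos i → c i ≠ 0 → j < pos' (σ i)) :
    ∀ x ∈ coordSubspace pos' j, permOp c σ x ∈ coordSubspace pos j := by
  intro x hx i hi
  rw [permOp_apply, mul_eq_zero, or_iff_not_imp_left]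
  exact fun hc => hx _ (h i hi hc)

/-! ### From the decay of the error to the number of rounds -/

lemma exists_quadratic_root {s : ℝ} (hs : 0 < s) :
    ∃ r : ℝ, 0 < r ∧ r < 1 ∧ 1 - r ^ 2 = s * r := by
  have hsq : √(s ^ 2 + 4) ^ 2 = s ^ 2 + 4 := Real.sq_sqrt (by positivity)
  have hlt : s < √(s ^ 2 + 4) := Real.lt_sqrt_of_sq_lt (by linarith)
  have hlt' : √(s ^ 2 + 4) < s + 2 := (Real.sqrt_lt' (by positivity)).2 (by nlinarith)
  exact ⟨(√(s ^ 2 + 4) - s) / 2, by linarith, by linarith, by linear_combination - hsq / 4⟩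

lemma log_div_le_of_pow_mul_le {r Z ε C : ℝ} {n : ℕ} (hr : 0 < r) (hZ : 0 < Z) (hε : 0 < ε)
    (hC : 0 < C) (h : r ^ n * Z ≤ C * ε) :
    Real.log (Z / ε) ≤ Real.log C + n * (1 / r - 1) := by
  have hlog := Real.log_le_log (by positivity) h
  rw [Real.log_mul (by positivity) hZ.ne', Real.log_pow, Real.log_mul hC.ne' hε.ne'] at hlog
  have hr' := mul_le_mul_of_nonneg_left (Real.one_sub_inv_le_log_of_pos hr) (Nat.cast_nonneg n)
  rw [Real.log_div hZ.ne' hε.ne', one_div]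
  linarith

lemma le_log_div_of_le_exp_neg_mul {Z ε a : ℝ} (hε : 0 < ε) (h : ε ≤ Real.exp (-a) * Z) :
    a ≤ Real.log (Z / ε) := by
  have hle : Real.exp a ≤ Z / ε := by
    rw [le_div_iff₀ hε]
    calc Real.exp a * ε ≤ Real.exp a * (Real.exp (-a) * Z) := by gcongr
      _ = Z := by rw [← mul_assoc, ← Real.exp_add, add_neg_cancel, Real.exp_zero, one_mul]
  exact (Real.le_log_iff_exp_le ((Real.exp_pos a).trans_le hle)).2 hle

/-- The rounding in `k / p`, the three extra powers of `r ^ 2` and the factor `3` cost at most `20`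
in the logarithm, half of it when `ε ≤ exp (-40) * Z`. -/
lemma mul_log_le_rounds {μ δ ρ r Z ε : ℝ} {k p : ℕ} (hμ : 0 < μ) (hδ : 2 * μ ≤ δ) (hρ : 0 < ρ)
    (hp : 1 / (6 * √ρ) ≤ p) (hr : 0 < r) (hrδ : 1 / r ≤ 1 + 6 * μ / δ) (hε : 0 < ε)
    (hZ : r ^ (2 * (k / p + 3)) * Z ≤ 3 * ε) (hεZ : ε ≤ Real.exp (-40) * Z) :
    1 / 216 * ((1 / √ρ) * (1 + δ / μ) * Real.log (Z / ε)) ≤ k := by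
  have hp0 : (0 : ℝ) < p := lt_of_lt_of_le (by positivity) hp
  have hδ0 : 0 < δ := by linarith
  have hZ0 : 0 < Z := pos_of_mul_pos_right (hε.trans_le hεZ) (Real.exp_pos _).le
  have hδμ : 2 ≤ δ / μ := (le_div_iff₀ hμ).2 hδ
  have hμδ : μ / δ ≤ 1 / 2 := by rw [← inv_div, one_div]; exact inv_anti₀ two_pos hδμ
  set Λ := Real.log (Z / ε)
  have hΛ : 40 ≤ Λ := le_log_div_of_le_exp_neg_mul hε hεZ
  have hΛk : Λ ≤ 24 * (k / p) * (μ / δ) := by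
    have hlog := log_div_le_of_pow_mul_le hr hZ0 hε three_pos hZ
    have hlog3 : Real.log 3 ≤ 2 := by
      linarith [Real.log_le_sub_one_of_pos (three_pos : (0 : ℝ) < 3)]
    have hkp : ((2 * (k / p + 3) : ℕ) : ℝ) ≤ 2 * (k / p + 3) := by
      push_cast
      gcongr
      exact Nat.cast_div_le
    have hstep : ((2 * (k / p + 3) : ℕ) : ℝ) * (1 / r - 1) ≤ 2 * (k / p + 3) * (6 * μ / δ) := by
      exact (mul_le_mul_of_nonneg_left (by linarith) (Nat.cast_nonneg _)).trans
        (mul_le_mul_of_nonneg_right hkp (by positivity))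
    have hexpand : 2 * ((k : ℝ) / p + 3) * (6 * μ / δ) = 12 * (k / p) * (μ / δ) + 36 * (μ / δ) := by
      ring
    linarith
  have hρp : 1 / √ρ ≤ 6 * p := by
    calc 1 / √ρ = 6 * (1 / (6 * √ρ)) := by ring
      _ ≤ 6 * p := by gcongr
  calc 1 / 216 * ((1 / √ρ) * (1 + δ / μ) * Λ)
      ≤ 1 / 216 * ((6 * p) * (3 / 2 * (δ / μ)) * (24 * (k / p) * (μ / δ))) := by
        gcongr
        linarith
    _ = k := by
        field_simp
        ring

/-! ### The bilinear chain -/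

/-- Weights of the edges `xᵢ – yᵢ` of the bilinear chain `x₀ – y₀ – x₁ – y₁ – ⋯ – x_N – y_N`. The
last one is tuned so that the geometric solution of the infinite chain survives truncation. -/
def diagWeight (N : ℕ) (η r : ℝ) (i : Fin (N + 1)) : ℝ :=
  if i = Fin.last N then η * √(1 - r ^ 2) else η

/-- Weights of the edges `yᵢ₋₁ – xᵢ` of the bilinear chain. -/
def shiftWeight (N : ℕ) (η : ℝ) (i : Fin (N + 1)) : ℝ := if i = 0 then 0 else -η

/-- The part of the bilinear chain made of the edges `xᵢ – yᵢ`. -/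
def diagCoupling (N : ℕ) (η r : ℝ) : Vec (N + 1) →L[ℝ] Vec (N + 1) :=
  permOp (diagWeight N η r) (Equiv.refl _)

/-- The part of the bilinear chain made of the edges `yᵢ₋₁ – xᵢ`. -/
def shiftCoupling (N : ℕ) (η : ℝ) : Vec (N + 1) →L[ℝ] Vec (N + 1) :=
  permOp (shiftWeight N η) (Equiv.subRight 1)

/-- The `x`-part of the solution of the bilinear chain. -/
def chainX (N : ℕ) (r : ℝ) : Vec (N + 1) := WithLp.toLp 2 fun i => r ^ (2 * (i : ℕ))

/-- The `y`-part of the solution of the bilinear chain. -/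
def chainY (N : ℕ) (r : ℝ) : Vec (N + 1) := WithLp.toLp 2 fun i =>
  if i = Fin.last N then r ^ (2 * N + 1) / √(1 - r ^ 2) else r ^ (2 * (i : ℕ) + 1)

/-- The position of `xᵢ` in the bilinear chain. -/
def posX {N : ℕ} (i : Fin (N + 1)) : ℕ := 2 * i

/-- The position of `yᵢ` in the bilinear chain. -/
def posY {N : ℕ} (i : Fin (N + 1)) : ℕ := 2 * i + 1

section Bilinear

variable {N : ℕ} {μ η r θ : ℝ}

lemma val_subRight_one {i : Fin (N + 1)} (hi : i ≠ 0) :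
    ((Equiv.subRight (1 : Fin (N + 1)) i : Fin (N + 1)) : ℕ) = i - 1 :=
  Fin.val_sub_one_of_ne_zero hi

lemma val_subRight_one_symm {i : Fin (N + 1)} (hi : i ≠ Fin.last N) :
    ((Equiv.subRight (1 : Fin (N + 1))).symm i : ℕ) = i + 1 :=
  Fin.val_add_one_of_lt (Fin.lt_last_iff_ne_last.2 hi)

lemma chainX_apply (i : Fin (N + 1)) : chainX N r i = r ^ (2 * (i : ℕ)) := rfl

lemma chainY_apply_last : chainY N r (Fin.last N) = r ^ (2 * N + 1) / √(1 - r ^ 2) := if_pos rfl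

lemma chainY_apply_of_ne_last {i : Fin (N + 1)} (hi : i ≠ Fin.last N) :
    chainY N r i = r ^ (2 * (i : ℕ) + 1) := if_neg hi

lemma norm_diagCoupling_le (hη : 0 ≤ η) : ‖diagCoupling N η r‖ ≤ η := by
  refine norm_permOp_le hη (fun i => ?_) _
  unfold diagWeight
  split_ifs
  · rw [abs_of_nonneg (by positivity)]
    exact mul_le_of_le_one_right hη (Real.sqrt_le_one.2 (sub_le_self _ (sq_nonneg r)))
  · rw [abs_of_nonneg hη]

lemma norm_shiftCoupling_le (hη : 0 ≤ η) : ‖shiftCoupling N η‖ ≤ η := by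
  refine norm_permOp_le hη (fun i => ?_) _
  unfold shiftWeight
  split_ifs
  · simpa using hη
  · rw [abs_neg, abs_of_nonneg hη]

lemma blockStable_diagCoupling (η r : ℝ) {j : ℕ} (hj : Odd j) :
    BlockStable 0 (diagCoupling N η r) (coordSubspace posX j) (coordSubspace posY j) where
  diag_x := diagOp_mem_coordSubspace
  diag_y := diagOp_mem_coordSubspace
  xx _ _ := Submodule.zero_mem _
  xy := permOp_mem_coordSubspace fun i hi _ => by
    simp only [posX, posY, Equiv.refl_apply] at hi ⊢
    omega
  yx := by
    obtain ⟨l, rfl⟩ := hj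
    rw [diagCoupling, adjoint_permOp]
    refine permOp_mem_coordSubspace fun i hi _ => ?_
    simp only [posX, posY, Equiv.refl_symm, Equiv.refl_apply] at hi ⊢
    omega

lemma blockStable_shiftCoupling (η : ℝ) {j : ℕ} (hj : Even j) :
    BlockStable 0 (shiftCoupling N η) (coordSubspace posX j) (coordSubspace posY j) where
  diag_x := diagOp_mem_coordSubspace
  diag_y := diagOp_mem_coordSubspace
  xx _ _ := Submodule.zero_mem _
  xy := permOp_mem_coordSubspace fun i hi hc => by
    obtain ⟨l, rfl⟩ := hj
    have h0 : i ≠ 0 := fun h0 => hc (if_pos h0)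
    simp only [posX, posY, val_subRight_one h0] at hi ⊢
    omega
  yx := by
    rw [shiftCoupling, adjoint_permOp]
    refine permOp_mem_coordSubspace fun i hi hc => ?_
    have hlast : i ≠ Fin.last N := by
      rintro rfl
      exact hc (if_pos (Fin.last_add_one N))
    simp only [posX, posY, val_subRight_one_symm hlast] at hi ⊢
    omega

lemma diagCoupling_chainY (hr : 0 < r) (hr1 : r < 1) (i : Fin (N + 1)) :
    diagCoupling N η r (chainY N r) i = η * r ^ (2 * (i : ℕ) + 1) := by
  have hs : 0 < √(1 - r ^ 2) := Real.sqrt_pos.2 (by nlinarith)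
  rw [diagCoupling, permOp_apply, Equiv.refl_apply, diagWeight]
  split_ifs with hi
  · rw [hi, chainY_apply_last, Fin.val_last]
    field_simp
  · rw [chainY_apply_of_ne_last hi]

lemma shiftCoupling_chainY {i : Fin (N + 1)} (hi : i ≠ 0) :
    shiftCoupling N η (chainY N r) i = -η * r ^ (2 * (i : ℕ) - 1) := by
  have hpos : 0 < (i : ℕ) := Fin.pos_iff_ne_zero.2 hi
  have hval := val_subRight_one hi
  have hlast : Equiv.subRight 1 i ≠ Fin.last N := fun h => by
    rw [h, Fin.val_last] at hval
    omega
  rw [shiftCoupling, permOp_apply, shiftWeight, if_neg hi, chainY_apply_of_ne_last hlast, hval]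
  congr 2
  omega

lemma chain_source_mem (hr : 0 < r) (hr1 : r < 1) (h : θ * η * (1 - r ^ 2) = μ * r) :
    μ • chainX N r + θ • (diagCoupling N η r + shiftCoupling N η) (chainY N r) ∈
      coordSubspace posX 0 := by
  intro i hi
  obtain ⟨l, hl⟩ : ∃ l, (i : ℕ) = l + 1 :=
    Nat.exists_eq_succ_of_ne_zero fun h0 => by simp [posX, h0] at hi
  have hi0 : i ≠ 0 := by
    rintro rfl
    simp at hl
  simp only [PiLp.add_apply, PiLp.smul_apply, _root_.add_apply, smul_eq_mul, chainX_apply,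
    diagCoupling_chainY hr hr1, shiftCoupling_chainY hi0, hl]
  rw [show 2 * (l + 1) - 1 = 2 * l + 1 by omega]
  linear_combination -r ^ (2 * l + 1) * h

lemma chain_response (hr : 0 < r) (hr1 : r < 1) (h : θ * η * (1 - r ^ 2) = μ * r) :
    ContinuousLinearMap.adjoint (θ • (diagCoupling N η r + shiftCoupling N η)) (chainX N r) =
      μ • chainY N r := by
  have hs2 : √(1 - r ^ 2) ^ 2 = 1 - r ^ 2 := Real.sq_sqrt (by nlinarith)
  have hs : 0 < √(1 - r ^ 2) := Real.sqrt_pos.2 (by nlinarith)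
  ext i
  simp only [map_smulₛₗ, map_add, conj_trivial, diagCoupling, shiftCoupling, adjoint_permOp,
    PiLp.add_apply, PiLp.smul_apply, _root_.add_apply, _root_.smul_apply, smul_eq_mul, permOp_apply,
    chainX_apply, Function.comp_apply, Equiv.refl_symm, Equiv.refl_apply]
  rcases eq_or_ne i (Fin.last N) with rfl | hi
  · have hzero : (Equiv.subRight (1 : Fin (N + 1))).symm (Fin.last N) = 0 := Fin.last_add_one N
    rw [hzero, shiftWeight, if_pos rfl, diagWeight, if_pos rfl, chainY_apply_last, Fin.val_last]
    field_simp
    linear_combination r ^ (2 * N) * h + θ * η * r ^ (2 * N) * hs2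
  · have hval := val_subRight_one_symm hi
    have hne : (Equiv.subRight (1 : Fin (N + 1))).symm i ≠ 0 := fun h0 => by simp [h0] at hval
    rw [hval, shiftWeight, if_neg hne, diagWeight, if_neg hi, chainY_apply_of_ne_last hi]
    linear_combination r ^ (2 * (i : ℕ)) * h

lemma one_sub_pow_four_mul_norm_chainX_sq_le (r : ℝ) : (1 - r ^ 4) * ‖chainX N r‖ ^ 2 ≤ 1 := by
  have hsum : ‖chainX N r‖ ^ 2 = ∑ i ∈ Finset.range (N + 1), (r ^ 4) ^ i := by
    rw [EuclideanSpace.real_norm_sq_eq, Finset.sum_range]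
    exact Finset.sum_congr rfl fun i _ => by rw [chainX_apply]; ring
  rw [hsum, mul_neg_geom_sum]
  linarith [show 0 ≤ (r ^ 4) ^ (N + 1) by positivity]

lemma sum_chainY_tail_sq (hr : r ^ 2 < 1) {i₀ : ℕ} (hi₀ : i₀ ≤ N) :
    (1 - r ^ 4) * ∑ i : Fin (N + 1), (if i₀ ≤ i then chainY N r i ^ 2 else 0) =
      r ^ 2 * ((r ^ 4) ^ i₀ + r ^ 2 * (r ^ 4) ^ N) := by
  have hcast : ∀ i : Fin N, (if i₀ ≤ i then chainY N r i.castSucc ^ 2 else 0) =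
      if i₀ ≤ i then r ^ 2 * (r ^ 4) ^ (i : ℕ) else 0 := fun i => by
    rw [chainY_apply_of_ne_last (Fin.castSucc_lt_last i).ne, Fin.val_castSucc]
    congr 1
    ring
  have hlast : (1 - r ^ 4) * chainY N r (Fin.last N) ^ 2 = r ^ 2 * ((1 + r ^ 2) * (r ^ 4) ^ N) := by
    have : 1 - r ^ 2 ≠ 0 := by linarith
    rw [chainY_apply_last, div_pow, Real.sq_sqrt (by linarith)]
    field_simp
    ring
  have hfilter : (Finset.range N).filter (fun i => i₀ ≤ i) = Finset.Ico i₀ N := by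
    ext i
    simp [and_comm]
  rw [Fin.sum_univ_castSucc]
  simp only [Fin.val_castSucc, Fin.val_last, if_pos hi₀, hcast]
  rw [← Finset.sum_range (fun i => if i₀ ≤ i then r ^ 2 * (r ^ 4) ^ i else 0),
    ← Finset.sum_filter, hfilter, ← Finset.mul_sum, mul_add, hlast]
  linear_combination r ^ 2 * geom_sum_Ico_mul_neg (r ^ 4) hi₀

lemma one_sub_pow_four_mul_norm_chainY_sq_le (hr : r ^ 2 < 1) :
    (1 - r ^ 4) * ‖chainY N r‖ ^ 2 ≤ 2 := by
  have hsum := sum_chainY_tail_sq (N := N) hr (Nat.zero_le N)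
  simp only [Nat.zero_le, if_true, pow_zero] at hsum
  have hr4 : (r ^ 4) ^ N ≤ 1 := pow_le_one₀ (by positivity) (by nlinarith [sq_nonneg r])
  have hr6 : r ^ 2 * (r ^ 4) ^ N ≤ 1 := mul_le_one₀ hr.le (by positivity) hr4
  rw [EuclideanSpace.real_norm_sq_eq, hsum]
  nlinarith [sq_nonneg r]

lemma pow_le_mul_norm_sub_chainY_sq (hr : r ^ 2 < 1) {j : ℕ} (hj : j ≤ N) {y : Vec (N + 1)}
    (hy : y ∈ coordSubspace posY j) :
    r ^ (2 * (j + 2)) ≤ (1 - r ^ 4) * ‖y - chainY N r‖ ^ 2 := by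
  set i₀ := (j + 1) / 2
  have htail : ∑ i : Fin (N + 1), (if i₀ ≤ i then chainY N r i ^ 2 else 0) ≤
      ‖y - chainY N r‖ ^ 2 := by
    rw [EuclideanSpace.real_norm_sq_eq]
    gcongr with i
    split_ifs with hi
    · simp [hy i (by simp only [posY]; omega)]
    · positivity
  have hr4 : 0 ≤ 1 - r ^ 4 := by nlinarith [sq_nonneg r]
  calc r ^ (2 * (j + 2)) = (r ^ 2) ^ (j + 2) := pow_mul r 2 _
    _ ≤ (r ^ 2) ^ (1 + 2 * i₀) := pow_le_pow_of_le_one (sq_nonneg r) hr.le (by omega)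
    _ = r ^ 2 * (r ^ 4) ^ i₀ := by ring
    _ ≤ r ^ 2 * ((r ^ 4) ^ i₀ + r ^ 2 * (r ^ 4) ^ N) := by
      gcongr
      exact le_add_of_nonneg_right (by positivity)
    _ = (1 - r ^ 4) * ∑ i : Fin (N + 1), (if i₀ ≤ i then chainY N r i ^ 2 else 0) :=
      (sum_chainY_tail_sq hr (by omega)).symm
    _ ≤ (1 - r ^ 4) * ‖y - chainY N r‖ ^ 2 := mul_le_mul_of_nonneg_left htail hr4

end Bilinear

section BilinearProblem

variable {L μ δ θ r : ℝ} {n p : ℕ} {h : Fin M → ℕ}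

lemma exists_chain_ratio (hμ : 0 < μ) (hδ : 0 < δ) (hθ : 1 / 3 ≤ θ) :
    ∃ r : ℝ, 0 < r ∧ r < 1 ∧ θ * (δ / 2) * (1 - r ^ 2) = μ * r ∧ 1 / r ≤ 1 + 6 * μ / δ := by
  have hθ0 : 0 < θ := by linarith
  obtain ⟨r, hr, hr1, hroot⟩ := exists_quadratic_root (s := μ / (θ * (δ / 2))) (by positivity)
  refine ⟨r, hr, hr1, by rw [hroot]; field_simp, ?_⟩
  calc 1 / r = r + μ / (θ * (δ / 2)) := by
        rw [div_eq_iff hr.ne']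
        linear_combination hroot
    _ ≤ 1 + μ / (1 / 3 * (δ / 2)) := by gcongr
    _ = 1 + 6 * μ / δ := by ring

/-- The bilinear chain, with the edges `xᵢ – yᵢ` at layer `0` and the edges `yᵢ₋₁ – xᵢ` at layer `p`
of the network, and the linear term that makes `(chainX N r, chainY N r)` its solution. -/
def bilinearProblem (N : ℕ) (μ δ θ r : ℝ) (h : Fin M → ℕ) (p : ℕ) (m : Fin M) : SFun (N + 1) :=
  quad μ (splitOp h p 0 0 m) (splitOp h p (diagCoupling N (δ / 2) r) (shiftCoupling N (δ / 2)) m)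
    (μ • chainX N r + θ • (diagCoupling N (δ / 2) r + shiftCoupling N (δ / 2)) (chainY N r))

variable {N : ℕ}

lemma isAdmissible_bilinearProblem [NeZero M] (hμ : 0 ≤ μ) (hδ : 0 ≤ δ) (hL : μ + δ / 2 ≤ L)
    (hr : 0 < r) (hr1 : r < 1) (hroot : (n / M : ℝ) * (δ / 2) * (1 - r ^ 2) = μ * r) (hp : 0 < p)
    (hbot : (Finset.univ.filter fun m => h m = 0).card = n)
    (htop : (Finset.univ.filter fun m => h m = p).card = n) :
    IsAdmissible L μ δ (bilinearProblem (N + 1) μ δ (n / M) r h p) (chainX (N + 1) r)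
      (chainY (N + 1) r) := by
  have hη : 0 ≤ δ / 2 := by positivity
  have hsqrt : 0 < √(1 - r ^ 2) := Real.sqrt_pos.2 (by nlinarith)
  have hP : ∀ m, splitOp h p (0 : Vec (N + 2) →L[ℝ] Vec (N + 2)) 0 m = 0 :=
    splitOp_induction (motive := (· = 0)) rfl rfl rfl
  have hQ : ∀ m, ‖splitOp h p (diagCoupling (N + 1) (δ / 2) r) (shiftCoupling (N + 1) (δ / 2)) m‖ ≤
      δ / 2 := splitOp_induction (motive := (‖·‖ ≤ δ / 2)) (norm_diagCoupling_le hη)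
    (norm_shiftCoupling_le hη) (by simpa using hη)
  refine isAdmissible_quad (C := 0) (D := δ / 2) hμ
    (fun m => by rw [hP]; exact ContinuousLinearMap.isPositive_zero)
    (fun m => by rw [hP, norm_zero]) hQ
    (by simpa using hδ) (by linarith) (by linarith) ?_ ?_ ?_ ?_
  · simp [opAverage_splitOp hp hbot htop]
  · rw [opAverage_splitOp hp hbot htop]
    exact chain_response hr hr1 hroot
  · exact fun h0 => by simpa [chainX_apply] using congr($h0 0)
  · refine fun h0 => ?_
    have := congr($h0 (Fin.last _))
    rw [chainY_apply_last] at this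
    exact absurd this (by positivity)

lemma splitFiltration_bilinearProblem (hμ : 0 < μ) (hr : 0 < r) (hr1 : r < 1)
    (hroot : θ * (δ / 2) * (1 - r ^ 2) = μ * r) :
    SplitFiltration (bilinearProblem N μ δ θ r h p) h p (coordSubspace posX)
      (coordSubspace posY) :=
  splitFiltration_quad hμ ContinuousLinearMap.isPositive_zero ContinuousLinearMap.isPositive_zero
    (chain_source_mem hr hr1 hroot) (fun _ => blockStable_diagCoupling _ _)
    (fun _ => blockStable_shiftCoupling _)

lemma pow_mul_le_of_mem_coordSubspace (hr : 0 < r) (hr1 : r < 1) {j : ℕ} (hj : j ≤ N)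
    {x y : Vec (N + 1)} (hy : y ∈ coordSubspace posY j) {ε Z : ℝ}
    (hε : ‖x - chainX N r‖ ^ 2 + ‖y - chainY N r‖ ^ 2 ≤ ε)
    (hZ : Z ≤ ‖chainX N r‖ ^ 2 + ‖chainY N r‖ ^ 2) :
    r ^ (2 * (j + 2)) * Z ≤ 3 * ε := by
  have hr2 : r ^ 2 < 1 := pow_lt_one₀ hr.le hr1 two_ne_zero
  have hr4 : 0 < 1 - r ^ 4 := sub_pos.2 (pow_lt_one₀ hr.le hr1 four_ne_zero)
  have herr : r ^ (2 * (j + 2)) ≤ (1 - r ^ 4) * ε :=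
    (pow_le_mul_norm_sub_chainY_sq hr2 hj hy).trans
      (mul_le_mul_of_nonneg_left (by linarith [sq_nonneg ‖x - chainX N r‖]) hr4.le)
  have hsize : (1 - r ^ 4) * Z ≤ 3 := by
    linarith [mul_le_mul_of_nonneg_left hZ hr4.le,
      one_sub_pow_four_mul_norm_chainX_sq_le (N := N) r,
      one_sub_pow_four_mul_norm_chainY_sq_le (N := N) hr2]
  refine le_of_mul_le_mul_left ?_ hr4
  calc (1 - r ^ 4) * (r ^ (2 * (j + 2)) * Z) = r ^ (2 * (j + 2)) * ((1 - r ^ 4) * Z) := by ring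
    _ ≤ r ^ (2 * (j + 2)) * 3 := by gcongr
    _ ≤ (1 - r ^ 4) * ε * 3 := by gcongr
    _ = (1 - r ^ 4) * (3 * ε) := by ring

lemma exists_bilinear_problem [NeZero M] {ρ : ℝ} (hμ : 0 < μ) (hδμ : 2 * μ ≤ δ) (hδL : δ < L)
    (hρ : 0 < ρ) (K : ℕ) {W : Matrix (Fin M) (Fin M) ℝ} (hh : IsHeight W h p)
    (hpρ : 1 / (6 * √ρ) ≤ p) (hn : M ≤ 3 * n)
    (hbot : (Finset.univ.filter fun m => h m = 0).card = n)
    (htop : (Finset.univ.filter fun m => h m = p).card = n) :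
    ∃ (d : ℕ) (f : Fin M → SFun d) (xs ys : Vec d), IsAdmissible L μ δ f xs ys ∧
      ∀ k ≤ K, ∀ x y : Vec d, IsOutput f W k x y →
        ∀ ε : ℝ, 0 < ε → ‖x - xs‖ ^ 2 + ‖y - ys‖ ^ 2 ≤ ε →
          ∀ Z : ℝ, Z ≤ ‖xs‖ ^ 2 + ‖ys‖ ^ 2 → ε ≤ Real.exp (-40) * Z →
            1 / 216 * ((1 / √ρ) * (1 + δ / μ) * Real.log (Z / ε)) ≤ k := by
  have hδ : 0 < δ := by linarith
  have hθ : (1 / 3 : ℝ) ≤ n / M := by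
    have hM : (0 : ℝ) < M := Nat.cast_pos.2 (Nat.pos_of_neZero M)
    rw [div_le_div_iff₀ three_pos hM]
    exact_mod_cast (by omega : 1 * M ≤ n * 3)
  obtain ⟨r, hr, hr1, hroot, hrδ⟩ := exists_chain_ratio hμ hδ hθ
  refine ⟨_, bilinearProblem (K + 1) μ δ (n / M) r h p, _, _,
    isAdmissible_bilinearProblem hμ.le hδ.le (by linarith) hr hr1 hroot hh.pos hbot htop, ?_⟩
  intro k hk x y hout ε hε hdist Z hZ hεZ
  have hlevel : k / p + 1 ≤ K + 1 := by have := Nat.div_le_self k p; omega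
  have hrounds : k < (k / p + 1) * p := by
    rw [add_one_mul]
    exact Nat.lt_div_mul_add hh.pos
  have hy := ((splitFiltration_bilinearProblem hμ hr hr1 hroot).mem_of_isOutput hh hrounds hout).2
  exact mul_log_le_rounds hμ hδμ hρ hpρ hr hrδ hε
    (pow_mul_le_of_mem_coordSubspace hr hr1 hlevel hy hdist hZ) hεZ

end BilinearProblem

/-! ### The hidden problem -/

/-- The involution of `Fin n` exchanging `i` and `i + 1` whenever `i + a` is even and both are in
range. -/
def pairSwap (n a : ℕ) : Equiv.Perm (Fin n) :=
  Function.Involutive.toPerm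
    (fun i => ⟨if (i + a) % 2 = 1 then i - 1 else if i + 1 < n then i + 1 else i, by
      split_ifs <;> omega⟩)
    fun i => by
      ext
      dsimp only
      split_ifs <;> omega

/-- The quadratic form `½⟨x, swapLap ν σ x⟩` of an involution `σ` is `ν/4 * ∑ᵢ (xᵢ - x_{σ i})²`. -/
def swapLap (ν : ℝ) (σ : Equiv.Perm (Fin d)) : Vec d →L[ℝ] Vec d := ν • (.id ℝ _ - permOp 1 σ)

/-- The coupling `η x_N y_N` of the last coordinates. -/
def lastCoupling (N : ℕ) (η : ℝ) : Vec (N + 1) →L[ℝ] Vec (N + 1) :=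
  permOp (Pi.single (Fin.last N) η) (Equiv.refl _)

lemma val_pairSwap {n : ℕ} (a : ℕ) (i : Fin n) : (pairSwap n a i : ℕ) =
    if ((i : ℕ) + a) % 2 = 1 then (i : ℕ) - 1 else if (i : ℕ) + 1 < n then (i : ℕ) + 1 else i := rfl

lemma involutive_pairSwap (n a : ℕ) : Function.Involutive (pairSwap n a) := by
  intro i
  ext
  simp only [val_pairSwap]
  split_ifs <;> omega

lemma lt_pairSwap {n a j : ℕ} (hj : Odd (j + a)) {i : Fin n} (hi : j < i) :
    j < pairSwap n a i := by
  obtain ⟨l, hl⟩ := hj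
  rw [val_pairSwap]
  split_ifs <;> omega

lemma pairSwap_succ_eq_or {N : ℕ} (j : Fin N) :
    (pairSwap (N + 1) 0 j.succ = j.castSucc ∧ j.castSucc < pairSwap (N + 1) 1 j.succ) ∨
      (pairSwap (N + 1) 1 j.succ = j.castSucc ∧ j.castSucc < pairSwap (N + 1) 0 j.succ) := by
  simp only [Fin.ext_iff, Fin.lt_def, val_pairSwap, Fin.val_succ, Fin.val_castSucc]
  split_ifs <;> omega

lemma swapLap_apply (ν : ℝ) (σ : Equiv.Perm (Fin d)) (x : Vec d) (i : Fin d) :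
    swapLap ν σ x i = ν * (x i - x (σ i)) := by
  simp [swapLap]

lemma lastCoupling_apply {N : ℕ} (η : ℝ) (x : Vec (N + 1)) (i : Fin (N + 1)) :
    lastCoupling N η x i = if i = Fin.last N then η * x (Fin.last N) else 0 := by
  rw [lastCoupling, permOp_apply, Pi.single_apply]
  split_ifs with hi
  · rw [hi, Equiv.refl_apply]
  · rw [zero_mul]

lemma adjoint_lastCoupling (N : ℕ) (η : ℝ) :
    ContinuousLinearMap.adjoint (lastCoupling N η) = lastCoupling N η := adjoint_permOp _ _

lemma norm_lastCoupling_le (N : ℕ) {η : ℝ} (hη : 0 ≤ η) : ‖lastCoupling N η‖ ≤ η := by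
  refine norm_permOp_le hη (fun i => ?_) _
  rw [Pi.single_apply]
  split_ifs
  · rw [abs_of_nonneg hη]
  · simpa using hη

lemma norm_swapLap_le {ν : ℝ} (hν : 0 ≤ ν) (σ : Equiv.Perm (Fin d)) : ‖swapLap ν σ‖ ≤ 2 * ν := by
  have hσ : ‖permOp 1 σ‖ ≤ 1 := norm_permOp_le zero_le_one (by simp) σ
  calc ‖swapLap ν σ‖ = ν * ‖.id ℝ (Vec d) - permOp 1 σ‖ := by
        rw [swapLap, norm_smul, Real.norm_of_nonneg hν]
    _ ≤ ν * (1 + 1) := by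
        gcongr
        exact norm_sub_le_of_le ContinuousLinearMap.norm_id_le hσ
    _ = 2 * ν := by ring

lemma isPositive_swapLap {ν : ℝ} (hν : 0 ≤ ν) {σ : Equiv.Perm (Fin d)}
    (hσ : Function.Involutive σ) : (swapLap ν σ).IsPositive := by
  have hadj : ContinuousLinearMap.adjoint (permOp 1 σ) = permOp 1 σ := by
    rw [adjoint_permOp, Function.Involutive.symm_eq_self_of_involutive σ hσ]
    rfl
  have hsq : swapLap ν σ = (ν / 2) • (ContinuousLinearMap.adjoint (.id ℝ _ - permOp 1 σ)).comp
      (.id ℝ _ - permOp 1 σ) := by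
    ext x i
    rw [map_sub, hadj, ContinuousLinearMap.adjoint_id]
    simp only [swapLap_apply, ContinuousLinearMap.comp_apply, _root_.smul_apply,
      _root_.sub_apply, ContinuousLinearMap.id_apply, map_sub, PiLp.smul_apply, PiLp.sub_apply,
      permOp_apply, Pi.one_apply, one_mul, hσ i, smul_eq_mul]
    ring
  rw [hsq]
  exact (ContinuousLinearMap.isPositive_adjoint_comp_self _).smul_of_nonneg (by positivity)

lemma swapLap_mem_coordSubspace (ν : ℝ) {σ : Equiv.Perm (Fin d)} {pos : Fin d → ℕ} {j : ℕ}
    (h : ∀ i, j < pos i → j < pos (σ i)) :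
    ∀ x ∈ coordSubspace pos j, swapLap ν σ x ∈ coordSubspace pos j := by
  intro x hx i hi
  rw [swapLap_apply, hx i hi, hx _ (h i hi), sub_zero, mul_zero]

lemma blockStable_bottom_hiddenProblem {N j : ℕ} (hN : Even N) (hj : Odd j) (ν η : ℝ) :
    BlockStable (swapLap ν (pairSwap (N + 1) 0)) (lastCoupling N η)
      (coordSubspace (fun i => i) j) (coordSubspace (fun _ => N + 1) j) where
  diag_x := diagOp_mem_coordSubspace
  diag_y := diagOp_mem_coordSubspace
  xx := swapLap_mem_coordSubspace ν fun _ => lt_pairSwap (a := 0) hj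
  xy := permOp_mem_coordSubspace fun i hi _ => hi.trans i.is_lt
  yx := by
    rw [adjoint_lastCoupling]
    refine permOp_mem_coordSubspace fun i hi hc => ?_
    obtain rfl : i = Fin.last N := by_contra fun hne => hc (Pi.single_eq_of_ne hne _)
    have hjN : j ≠ N := by
      rintro rfl
      exact Nat.not_even_iff_odd.2 hj hN
    simp only [Equiv.refl_apply, Fin.val_last]
    omega

lemma blockStable_top_hiddenProblem {N j : ℕ} (hj : Even j) (ν : ℝ) :
    BlockStable (swapLap ν (pairSwap (N + 1) 1)) 0
      (coordSubspace (fun i => i) j) (coordSubspace (fun _ => N + 1) j) where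
  diag_x := diagOp_mem_coordSubspace
  diag_y := diagOp_mem_coordSubspace
  xx := swapLap_mem_coordSubspace ν fun _ => lt_pairSwap hj.add_one
  xy := fun _ _ => Submodule.zero_mem _
  yx := fun _ _ => by simp

/-- The path `x₀ – x₁ – ⋯ – x_N` with its edges alternating between the two ends of the network.
Only `x_N` interacts with `y`, so `y` stays zero until the whole path has been explored. -/
def hiddenProblem (N : ℕ) (μ ν η : ℝ) (h : Fin M → ℕ) (p : ℕ) (m : Fin M) : SFun (N + 1) :=
  quad μ (splitOp h p (swapLap ν (pairSwap (N + 1) 0)) (swapLap ν (pairSwap (N + 1) 1)) m)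
    (splitOp h p (lastCoupling N η) 0 m) (EuclideanSpace.single 0 1)

lemma splitFiltration_hiddenProblem {N : ℕ} (hN : Even N) {μ ν : ℝ} (hμ : 0 < μ) (hν : 0 ≤ ν)
    (η : ℝ) (h : Fin M → ℕ) (p : ℕ) :
    SplitFiltration (hiddenProblem N μ ν η h p) h p (coordSubspace fun i => i)
      (coordSubspace fun _ => N + 1) :=
  splitFiltration_quad hμ (isPositive_swapLap hν (involutive_pairSwap _ _))
    (isPositive_swapLap hν (involutive_pairSwap _ _))
    (fun _ hi => by simp [(Fin.pos_iff_ne_zero.1 hi)])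
    (fun _ hj => blockStable_bottom_hiddenProblem hN hj ν η)
    (fun _ hj => blockStable_top_hiddenProblem hj ν)

/-- Read from its last coordinate downwards, the stationarity equation determines each coordinate
by the later ones, so `x_N = 0` would propagate to `x = 0`. -/
lemma last_ne_zero_of_stationary {N : ℕ} {μ θ ν η : ℝ} (hμ : μ ≠ 0) (hθν : θ * ν ≠ 0)
    {x y : Vec (N + 1)}
    (hx : μ • x + (θ • (swapLap ν (pairSwap (N + 1) 0) + swapLap ν (pairSwap (N + 1) 1))) x +
      (θ • lastCoupling N η) y = EuclideanSpace.single 0 1)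
    (hy : ContinuousLinearMap.adjoint (θ • lastCoupling N η) x = μ • y) :
    x (Fin.last N) ≠ 0 := by
  intro hlast
  have hcoord : ∀ i, μ * x i + θ * ν * (x i - x (pairSwap (N + 1) 0 i)) +
      θ * ν * (x i - x (pairSwap (N + 1) 1 i)) + θ * lastCoupling N η y i =
        if i = 0 then 1 else 0 := by
    intro i
    have := congr($hx i)
    simp only [PiLp.add_apply, PiLp.smul_apply, _root_.smul_apply, _root_.add_apply,
      smul_eq_mul, swapLap_apply, PiLp.single_apply] at this
    rw [← this]
    ring
  have hQy : ∀ i, lastCoupling N η y i = 0 := by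
    have := congr($hy (Fin.last N))
    simp only [map_smulₛₗ, adjoint_lastCoupling, _root_.smul_apply, PiLp.smul_apply,
      lastCoupling_apply, if_true, hlast, smul_eq_mul, mul_zero, zero_eq_mul, hμ, false_or] at this
    simp [lastCoupling_apply, this]
  have hzero : ∀ i j, i ≤ j → x j = 0 := by
    intro i
    induction i using Fin.reverseInduction with
    | last => exact fun j hj => Fin.last_le_iff.1 hj ▸ hlast
    | cast i ih =>
      intro j hij
      have hlt : ∀ j, i.castSucc < j → x j = 0 := fun j hj =>
        ih j (Fin.castSucc_lt_iff_succ_le.1 hj)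
      rcases hij.eq_or_lt with rfl | hj
      · have hi := hcoord i.succ
        rw [hQy, hlt _ i.castSucc_lt_succ, if_neg (Fin.succ_ne_zero i)] at hi
        rcases pairSwap_succ_eq_or i with ⟨hswap, hother⟩ | ⟨hswap, hother⟩ <;>
          simpa [hswap, hlt _ hother, hθν] using hi
      · exact hlt j hj
  have := hcoord 0
  simp [hzero 0, hQy] at this

section HiddenProblem

variable [NeZero M] {L μ δ : ℝ} {h : Fin M → ℕ} {p n : ℕ}

lemma exists_isAdmissible_hiddenProblem (N : ℕ) {C : ℝ} (hμ : 0 < μ) (hC : 0 < C) (hCδ : C ≤ δ)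
    (hCL : C ≤ L - μ) (hp : 0 < p) (hn : 0 < n)
    (hbot : (Finset.univ.filter fun m => h m = 0).card = n)
    (htop : (Finset.univ.filter fun m => h m = p).card = n) :
    ∃ xs ys, IsAdmissible L μ δ (hiddenProblem N μ (C / 4) (C / 2) h p) xs ys := by
  have hθ : (0 : ℝ) < n / M := div_pos (Nat.cast_pos.2 hn) (Nat.cast_pos.2 (Nat.pos_of_neZero M))
  have hpos : ∀ a, (swapLap (C / 4) (pairSwap (N + 1) a)).IsPositive := fun a =>
    isPositive_swapLap (by positivity) (involutive_pairSwap _ _)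
  have hnorm : ∀ a, ‖swapLap (C / 4) (pairSwap (N + 1) a)‖ ≤ C / 2 := fun a =>
    (norm_swapLap_le (by positivity) _).trans (by linarith)
  have hnorm_zero : ‖(0 : Vec (N + 1) →L[ℝ] Vec (N + 1))‖ ≤ C / 2 := by
    rw [norm_zero]
    positivity
  have hP := splitOp_induction (h := h) (p := p) (motive := ContinuousLinearMap.IsPositive)
    (hpos 0) (hpos 1) ContinuousLinearMap.isPositive_zero
  have hPC := splitOp_induction (h := h) (p := p) (motive := (‖·‖ ≤ C / 2))
    (hnorm 0) (hnorm 1) hnorm_zero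
  have hQC := splitOp_induction (h := h) (p := p) (motive := (‖·‖ ≤ C / 2))
    (norm_lastCoupling_le N (by positivity : 0 ≤ C / 2)) hnorm_zero hnorm_zero
  have hQ : opAverage (splitOp h p (lastCoupling N (C / 2)) 0) =
      ((n : ℝ) / M) • lastCoupling N (C / 2) := by
    rw [opAverage_splitOp hp hbot htop, add_zero]
  obtain ⟨xs, ys, hx, hy⟩ := exists_stationary_point (isPositive_opAverage hP) hμ
    (opAverage (splitOp h p (lastCoupling N (C / 2)) 0)) (EuclideanSpace.single 0 1)
  have hlast : xs (Fin.last N) ≠ 0 := by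
    rw [hQ] at hx hy
    rw [opAverage_splitOp hp hbot htop] at hx
    exact last_ne_zero_of_stationary hμ.ne' (by positivity) hx hy
  refine ⟨xs, ys, isAdmissible_quad hμ.le hP hPC hQC (by linarith) (by linarith) (by linarith)
    hx hy (fun h0 => hlast (by simp [h0])) fun h0 => ?_⟩
  rw [hQ, h0] at hy
  have := congr($hy (Fin.last N))
  simp [adjoint_lastCoupling, lastCoupling_apply, hlast, hθ.ne', hC.ne'] at this

lemma exists_hidden_problem (hμ : 0 < μ) (hδ : 0 < δ) (hμL : μ < L) (K : ℕ)
    {W : Matrix (Fin M) (Fin M) ℝ} (hh : IsHeight W h p) (hn : 0 < n)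
    (hbot : (Finset.univ.filter fun m => h m = 0).card = n)
    (htop : (Finset.univ.filter fun m => h m = p).card = n) :
    ∃ (d : ℕ) (f : Fin M → SFun d) (xs ys : Vec d), IsAdmissible L μ δ f xs ys ∧
      ∀ k ≤ K, ∀ x y : Vec d, IsOutput f W k x y → y = 0 := by
  have hC : 0 < min δ (L - μ) := lt_min hδ (sub_pos.2 hμL)
  obtain ⟨xs, ys, hadm⟩ := exists_isAdmissible_hiddenProblem (2 * (K + 1)) hμ hC
    (min_le_left _ _) (min_le_right _ _) hh.pos hn hbot htop
  refine ⟨_, _, xs, ys, hadm, fun k hk x y hout => ?_⟩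
  have hrounds : k < (K + 1) * p :=
    (Nat.lt_succ_of_le hk).trans_le (Nat.le_mul_of_pos_right _ hh.pos)
  have hy := ((splitFiltration_hiddenProblem (even_two_mul _) hμ (by positivity) _ h
    p).mem_of_isOutput hh hrounds hout).2
  ext i
  refine hy i ?_
  dsimp only
  omega

end HiddenProblem

end

end DistSPP

open DistSPP in
theorem mainTheorem4 :
    ∃ c c₀ : ℝ, 0 < c ∧ 0 < c₀ ∧
      ∀ L μ δ ρ : ℝ, 0 < μ → 0 < δ → μ < L → δ < L → 0 < ρ → ρ ≤ 1 → ∀ K : ℕ,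
        ∃ (d M : ℕ) (hM : 2 ≤ M) (f : Fin M → SFun d) (xs ys : Vec d)
          (G : SimpleGraph (Fin M)) (W : Matrix (Fin M) (Fin M) ℝ) (hW : IsGossip G W),
          (∀ m, TwiceDifferentiable (f m) ∧ Smooth L (f m) ∧ StronglyConvexConcave μ (f m)) ∧
          StronglyConvexConcave μ (average f) ∧
          Related δ f ∧
          IsSolution (average f) xs ys ∧ xs ≠ 0 ∧ ys ≠ 0 ∧
          G.Connected ∧ eigengap hM hW.symm = ρ ∧
          ∀ k ≤ K, ∀ x y : Vec d, IsOutput f W k x y →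
            ∀ ε : ℝ, 0 < ε → ‖x - xs‖ ^ 2 + ‖y - ys‖ ^ 2 ≤ ε →
              (ε ≤ c₀ * ‖ys‖ ^ 2 →
                c * ((1 / √ρ) * (1 + δ / μ) * Real.log (‖ys‖ ^ 2 / ε)) ≤ (k : ℝ)) ∧
              (2 * μ ≤ δ → ε ≤ c₀ * (‖xs‖ ^ 2 + ‖ys‖ ^ 2) →
                c * ((1 / √ρ) * (1 + δ / μ) * Real.log ((‖xs‖ ^ 2 + ‖ys‖ ^ 2) / ε)) ≤
                  (k : ℝ)) := by
  refine ⟨1 / 216, Real.exp (-40), by norm_num, Real.exp_pos _, ?_⟩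
  intro L μ δ ρ hμ hδ hμL hδL hρ hρ1 K
  obtain ⟨M, hM, G, W, hW, h, p, n, hG, hgap, hh, hpρ, hn, hbot, htop⟩ := exists_network hρ hρ1
  have : NeZero M := ⟨by omega⟩
  by_cases hμδ : 2 * μ ≤ δ
  · obtain ⟨d, f, xs, ys, ⟨hreg, havg, hrel, hsol, hxs, hys⟩, hrounds⟩ :=
      exists_bilinear_problem hμ hμδ hδL hρ K hh hpρ hn hbot htop
    refine ⟨d, M, hM, f, xs, ys, G, W, hW, hreg, havg, hrel, hsol, hxs, hys, hG, hgap, ?_⟩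
    intro k hk x y hout ε hε hdist
    exact ⟨hrounds k hk x y hout ε hε hdist _ (le_add_of_nonneg_left (sq_nonneg _)),
      fun _ => hrounds k hk x y hout ε hε hdist _ le_rfl⟩
  · obtain ⟨d, f, xs, ys, ⟨hreg, havg, hrel, hsol, hxs, hys⟩, hhidden⟩ :=
      exists_hidden_problem hμ hδ hμL K hh (by omega) hbot htop
    refine ⟨d, M, hM, f, xs, ys, G, W, hW, hreg, havg, hrel, hsol, hxs, hys, hG, hgap, ?_⟩
    intro k hk x y hout ε _ hdist
    refine ⟨fun hε => absurd hε (not_le.2 ?_), fun hμδ' => absurd hμδ' hμδ⟩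
    rw [hhidden k hk x y hout, zero_sub, norm_neg] at hdist
    calc Real.exp (-40) * ‖ys‖ ^ 2 < ‖ys‖ ^ 2 :=
          mul_lt_of_lt_one_left (by positivity) (Real.exp_lt_one_iff.2 (by norm_num))
      _ ≤ ε := (le_add_of_nonneg_left (sq_nonneg _)).trans hdist
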